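/- Let $z=(z^1,z^2)$ be inhomogeneous coordinates on $\mathbb{CP}^2$, let $y^1,y^2,y^3$ be the moment map coordinates, $y^1+y^2+y^3=1$, $|z^1|^2=y^1/y^3$, $|z^2|^2=y^2/y^3$, put $c_3=y^1y^2y^3$, and let $T=\{z^1z^2\neq0\}$ be the open dense torus, where all $y^i>0$. Let $I_-$ be the standard complex structure, $\sigma=iz^1z^2\,\partial_{z^1}\wedge\partial_{z^2}$, $Q_{\mathrm H}=4\,\mathrm{Im}\,\sigma$, $h=-\frac14\log c_3$, $V=Q_{\mathrm H}^{\#}dh=Q_{\mathrm H}(\cdot,dh)$. Let $X$ be the symplectic groupoid of $\sigma$ with coordinates $(z^1,z^2,\xi_1,\xi_2)$, source $\mathtt s(z,\xi)=z$, target $\mathtt t(z,\xi)=(z^1e^{\xi_2z^2},z^2e^{-\xi_1z^1})$, space of units $L_0=\{\xi=0\}$, and holomorphic symplectic form $\Omega_0=i\sum_k dp_k\wedge dq^k$, where $$q^1=z^1e^{\xi_2z^2/2},\quad q^2=z^2e^{-\xi_1z^1/2},\quad p_1=\xi_1e^{-\xi_2z^2/2},\quad p_2=\xi_2e^{\xi_1z^1/2}.$$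 Let $\hat V$ be the vector field $4\,\mathrm{Im}(\Omega_0^{-1})(\cdot,d(h\circ\mathtt t))$ over $T$. Then $V$ and $\hat V$ have complete flows $\phi_t$ on $T$ and $\hat\phi_t$ on $X|_T$, with $\mathtt t\circ\hat\phi_t=\phi_t\circ\mathtt t$ and $\mathtt s\circ\hat\phi_t=\mathtt s$. Moreover, for every $t\in\mathbb R$: 1. There is a real 2-form $F$ on $T$ with $I_+-I_-=-Q_{\mathrm H}F$, where $I_+=(\phi_{t*})^{-1}I_-\phi_{t*}$, and $(P,Q)=(p\circ\hat\phi_t,q\circ\hat\phi_t)$ are Darboux coordinates for $\Omega=\Omega_0+\mathtt t^*F$, i.e. they are local coordinates and $\Omega=i\sum_kdP_k\wedge dQ^k$. 2. The function $$K=\frac t4\log c_3+\frac38\int_0^t\sum_{i=1}^3y^i_s\log\frac{y^i_s}{y^i_0}\,ds,\qquad y^i_s=y^i\circ\phi_s,$$ on $T\cong L_0|_T$ is the generalised Kähler potential of the flowed structure in these coordinates: $\mathrm{Re}\big(\sum_kP_kdQ^k\big)\big|_{L_0}=-dK$ on $T$, and near every point at which $Q|_{L_0}$ has invertible differential, $L_0$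 is the graph $P_k=-2\,\partial K/\partial Q^k$, with $K$ seen as a function of $(Q,\bar Q)$. Equivalently, the flowed unit Lagrangian $L_t=\hat\phi_t(L_0)$ is the graph $p_k=-2\,\partial K/\partial q^k$ in the Darboux coordinates $(p,q)$ of $\Omega_0$. At each point of $T$ the differential of $Q|_{L_0}$ is invertible for all sufficiently small $|t|$. 3. The $y^i_s$ are elliptic functions of $s$: let $z\in T$, $c_3=c_3(z)$, and let $\wp$ be the Weierstrass function of a lattice with half-periods $\omega_1\in\mathbb R_{>0}$, $\omega_2\in i\mathbb R_{>0}$ and invariants $g_2=\frac1{12}-2c_3$, $g_3=\frac{c_3}6-\frac1{216}-c_3^2$. Then there is a real $t_0$ such that for all $s\in\mathbb R$ and $k=1,2,3$ $$y^k_s(z)=\frac{c_3}{\frac1{12}-\wp\big(\omega_2+t_0+s+\frac{2k}{3}\omega_1\big)}.$$ -/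

import Mathlib

open Complex

noncomputable section

namespace GKP

/-! ### Generalities on `ℂⁿ`, viewed as a real manifold

A holomorphic bivector `½ ∑ π j k ∂_j ∧ ∂_k` (so that `{z_j, z_k} = π j k`), or a holomorphic
2-form `½ ∑ ω j k dz_j ∧ dz_k`, is given at a point by an antisymmetric complex matrix; a real
tangent vector is given by its complex coordinates. -/

/-- The `(1,0)`-components of a real covector: `α = ∑ α_k dz_k + conj`, where
`α_k = ½ (α(∂_{x_k}) - i α(∂_{y_k}))`. -/
def comp10 {n : ℕ} (α : (Fin n → ℂ) →L[ℝ] ℝ) (k : Fin n) : ℂ :=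
  ((α (Pi.single k 1) : ℂ) - I * (α (Pi.single k I) : ℂ)) / 2

/-- The holomorphic derivative `∂f/∂z_k` of a real function. -/
def dHol {n : ℕ} (f : (Fin n → ℂ) → ℝ) (z : Fin n → ℂ) (k : Fin n) : ℂ :=
  comp10 (fderiv ℝ f z) k

/-- The real bivector `4 Im π` of a holomorphic bivector `π`, evaluated on real covectors. -/
def fourIm {n : ℕ} (π : Matrix (Fin n) (Fin n) ℂ) (α β : (Fin n → ℂ) →L[ℝ] ℝ) : ℝ :=
  4 * (∑ j, ∑ k, π j k * comp10 α j * comp10 β k).im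

/-- The real tangent vector `B^# α = B(·, α)` for the real bivector `B = 4 Im π`. -/
def sharp {n : ℕ} (π : Matrix (Fin n) (Fin n) ℂ) (α : (Fin n → ℂ) →L[ℝ] ℝ) : Fin n → ℂ :=
  fun j => -2 * I * ∑ k, π j k * comp10 α k

/-- The defining property of `sharp`. -/
theorem apply_sharp {n : ℕ} (π : Matrix (Fin n) (Fin n) ℂ) (α β : (Fin n → ℂ) →L[ℝ] ℝ) :
    β (sharp π α) = fourIm π β α := by
  have key : ∀ v : Fin n → ℂ, β v = 2 * (∑ j, comp10 β j * v j).re := by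
    intro v
    have hv : v = ∑ j, ((v j).re • Pi.single (M := fun _ => ℂ) j (1 : ℂ)
        + (v j).im • Pi.single (M := fun _ => ℂ) j I) := by
      ext i
      simp [Finset.sum_apply, Pi.single_apply, Finset.sum_add_distrib]
    conv_lhs => rw [hv]
    simp only [map_sum, map_add, map_smul, smul_eq_mul, Complex.re_sum, Finset.mul_sum]
    refine Finset.sum_congr rfl fun j _ => ?_
    simp [comp10]
    ring
  rw [key, fourIm]
  have : (∑ j, comp10 β j * sharp π α j)
      = -2 * I * ∑ j, ∑ k, π j k * comp10 β j * comp10 α k := by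
    simp only [sharp, Finset.mul_sum]
    refine Finset.sum_congr rfl fun j _ => Finset.sum_congr rfl fun k _ => ?_
    ring
  rw [this]
  simp [Complex.mul_re]
  ring

/-- `φ` is the (complete) flow of the vector field `W` on the set `U`. -/
def IsFlowOn {E : Type*} [NormedAddCommGroup E] [NormedSpace ℝ E]
    (U : Set E) (W : E → E) (φ : ℝ → E → E) : Prop :=
  ∀ x ∈ U, φ 0 x = x ∧ ∀ t, φ t x ∈ U ∧ HasDerivAt (fun s => φ s x) (W (φ t x)) t

/-! ### The complex projective plane: inhomogeneous coordinates, moment map, Poisson structure -/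

/-- The affine chart of `ℂP²` with inhomogeneous coordinates `z = (z₁, z₂)`. -/
abbrev Chart := Fin 2 → ℂ

/-- The open dense torus orbit of `ℂP²`, i.e. the locus where no `yⁱ` vanishes. -/
def torus : Set Chart := {z | z 0 ≠ 0 ∧ z 1 ≠ 0}

/-- The moment map coordinates `(y¹, y², y³)`, where `y¹ + y² + y³ = 1`;
they are determined by `|z₁|² = y¹/y³` and `|z₂|² = y²/y³`. -/
def y (z : Chart) : Fin 3 → ℝ :=
  ![‖z 0‖ ^ 2 / (1 + ‖z 0‖ ^ 2 + ‖z 1‖ ^ 2), ‖z 1‖ ^ 2 / (1 + ‖z 0‖ ^ 2 + ‖z 1‖ ^ 2),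
    1 / (1 + ‖z 0‖ ^ 2 + ‖z 1‖ ^ 2)]

/-- `c₃ = y¹ y² y³`. -/
def c₃ (z : Chart) : ℝ := y z 0 * y z 1 * y z 2

/-- The Hamiltonian `h = -¼ log (y¹ y² y³)`. -/
def h (z : Chart) : ℝ := -(1 / 4) * Real.log (c₃ z)

/-- The holomorphic Poisson tensor `σ = i z₁ z₂ ∂₁ ∧ ∂₂`. Hitchin's Poisson structure is
`Q = 4 Im σ`. -/
def sigma (z : Chart) : Matrix (Fin 2) (Fin 2) ℂ :=
  !![0, I * z 0 * z 1; -(I * z 0 * z 1), 0]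

/-- The vector field `V = Q^# dh`. -/
def V (z : Chart) : Chart := sharp (sigma z) (fderiv ℝ h z)

/-- The deformed complex structure `I₊ = (φ_*)⁻¹ I₋ φ_*`, where `I₋` is multiplication by `i`. -/
def Iplus (φ : Chart → Chart) (z u : Chart) : Chart :=
  (fderiv ℝ φ z).inverse (I • fderiv ℝ φ z u)

/-! ### The symplectic groupoid of `σ` over the chart -/

/-- The part of the groupoid `X = T*ℂP²` over the chart, with coordinates
`x = (z₁, z₂, ξ₁, ξ₂)`. -/
abbrev X := Fin 4 → ℂ

/-- The part of the groupoid over the open dense torus. -/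
def torusX : Set X := {x | x 0 ≠ 0 ∧ x 1 ≠ 0}

/-- The holomorphic symplectic form `Ω₀`, as a matrix:
`i Ω₀ = -ξ₁ξ₂ dz₁∧dz₂ - ξ₁z₂ dz₁∧dξ₂ + dz₁∧dξ₁ + dz₂∧dξ₂ + ξ₂z₁ dz₂∧dξ₁ - z₁z₂ dξ₁∧dξ₂`. -/
def OmegaMatrix (x : X) : Matrix (Fin 4) (Fin 4) ℂ :=
  (-I) • !![0, -(x 2 * x 3), 1, -(x 2 * x 1);
            x 2 * x 3, 0, x 3 * x 0, 1;
            -1, -(x 3 * x 0), 0, -(x 0 * x 1);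
            x 2 * x 1, -1, x 0 * x 1, 0]

/-- `Ω₀` evaluated on two tangent vectors. -/
def Omega (x u v : X) : ℂ := u ⬝ᵥ (OmegaMatrix x).mulVec v

/-- `Ω₀` is invertible everywhere; its inverse is the Poisson tensor
`-i Ω₀⁻¹ = ∂_{ξ₁}∧∂_{z₁} + ∂_{ξ₂}∧∂_{z₂} - ξ₁ξ₂ ∂_{ξ₁}∧∂_{ξ₂} + ξ₁z₂ ∂_{ξ₁}∧∂_{z₂}
- ξ₂z₁ ∂_{ξ₂}∧∂_{z₁} - z₁z₂ ∂_{z₁}∧∂_{z₂}`. -/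
theorem OmegaMatrix_inv (x : X) :
    (OmegaMatrix x)⁻¹ = I • !![0, -(x 0 * x 1), -1, x 3 * x 0;
            x 0 * x 1, 0, -(x 2 * x 1), -1;
            1, x 2 * x 1, 0, -(x 2 * x 3);
            -(x 3 * x 0), 1, x 2 * x 3, 0] := by
  apply Matrix.inv_eq_right_inv
  ext i j
  fin_cases i <;> fin_cases j <;>
    simp [OmegaMatrix, Matrix.mul_apply, Fin.sum_univ_four] <;> ring_nf

/-- The target map `t(z, ξ) = (z₁ e^{ξ₂z₂}, z₂ e^{-ξ₁z₁})`; the source map is `(z, ξ) ↦ z`. -/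
def target (x : X) : Chart := ![x 0 * exp (x 3 * x 1), x 1 * exp (-(x 2 * x 0))]

/-- The inclusion of the space of units `L₀ = {ξ = 0}`. -/
def unit (z : Chart) : X := ![z 0, z 1, 0, 0]

/-- The lift `V̂ = -(Im Ω₀)^{-#} (t^* dh) = (4 Im Ω₀⁻¹)^# d(h ∘ t)` of `V` to the groupoid. -/
def Vhat (x : X) : X := sharp (OmegaMatrix x)⁻¹ (fderiv ℝ (fun x' => h (target x')) x)

/-- The Darboux coordinates `q₁ = z₁ e^{ξ₂z₂/2}`, `q₂ = z₂ e^{-ξ₁z₁/2}` of `Ω₀`. -/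
def q (x : X) : Fin 2 → ℂ := ![x 0 * exp (x 3 * x 1 / 2), x 1 * exp (-(x 2 * x 0 / 2))]

/-- The Darboux coordinates `p₁ = ξ₁ e^{-ξ₂z₂/2}`, `p₂ = ξ₂ e^{ξ₁z₁/2}` of `Ω₀`. -/
def p (x : X) : Fin 2 → ℂ := ![x 2 * exp (-(x 3 * x 1 / 2)), x 3 * exp (x 2 * x 0 / 2)]

/-! ### The generalised Kähler potential -/

/-- `(P, Q)` are Darboux coordinates on `W` for the complex-valued 2-form `Ω`:
they are local coordinates and `Ω = i ∑ dP_k ∧ dQ^k`. -/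
structure IsDarbouxOn (W : Set X) (Ω : X → X → X → ℂ) (P Q : X → Fin 2 → ℂ) : Prop where
  differentiableAt_P : ∀ x ∈ W, DifferentiableAt ℝ P x
  differentiableAt_Q : ∀ x ∈ W, DifferentiableAt ℝ Q x
  bijective : ∀ x ∈ W, Function.Bijective (fun u => (fderiv ℝ P x u, fderiv ℝ Q x u))
  form_eq : ∀ x ∈ W, ∀ u v, Ω x u v =
    I * ∑ k, (fderiv ℝ P x u k * fderiv ℝ Q x v k - fderiv ℝ P x v k * fderiv ℝ Q x u k)

/-- `K : S → ℝ` is a generalised Kähler potential for the 2-form `Ω` in the Darboux coordinates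
`(P, Q)`: with `η = ∑ P_k dQ^k` restricted to the space of units `L₀` (identified with the base by
`unit`), one has `Re η = -dK`, and near every point where `Q` restricts to a local coordinate
system on `L₀`, the units are the graph `P_k = -2 ∂K/∂Q^k`, where `K` is seen as a function of
`(Q, Q̄)`. -/
structure IsGKPOn (S : Set Chart) (Ω : X → X → X → ℂ) (P Q : X → Fin 2 → ℂ)
    (K : Chart → ℝ) : Prop where
  darboux : IsDarbouxOn torusX Ω P Q
  differentiableAt : ∀ z ∈ S, DifferentiableAt ℝ K z
  re_eta : ∀ z ∈ S, ∀ v,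
    (∑ k, P (unit z) k * fderiv ℝ (fun z' => Q (unit z')) z v k).re = -fderiv ℝ K z v
  graph : ∀ z ∈ S, Function.Bijective (fderiv ℝ (fun z' => Q (unit z')) z) →
    ∃ e : OpenPartialHomeomorph Chart (Fin 2 → ℂ),
      z ∈ e.source ∧ e.source ⊆ S ∧ (∀ z' ∈ e.source, e z' = Q (unit z')) ∧
      DifferentiableOn ℝ e.symm e.target ∧
      ∀ w ∈ e.target, ∀ k, P (unit (e.symm w)) k = -2 * dHol (fun w' => K (e.symm w')) w k

/-- The function
`K = (t/4) log c₃ + (3/8) ∫₀ᵗ ∑ᵢ yⁱ_s log (yⁱ_s / yⁱ_0) ds`, where `yⁱ_s = yⁱ ∘ φ_s`. -/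
def potential (φ : ℝ → Chart → Chart) (t : ℝ) (z : Chart) : ℝ :=
  t / 4 * Real.log (c₃ z)
    + 3 / 8 * ∫ s in (0 : ℝ)..t, ∑ i, y (φ s z) i * Real.log (y (φ s z) i / y z i)

end GKP

end

/-!
The vector field `V` commutes with the rotations of the torus, so everything reduces to a planar
Hamiltonian system. In the logarithmic coordinates `r = (log |z₁|, log |z₂|)` the field `V` is
the real, bounded Hamiltonian vector field `field` of `ham = h`, with arguments kept fixed. Its flow
`ρ_t` is complete and differentiable, its derivative solves the variational equation
(`IsFlowWithVariation`), it preserves `ham` (`ham_flow`) and the area (`det_var`). With the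
displacement `R = ρ_t(r) - r`, the flows on the torus and on the groupoid are explicit:
`φ_t(z) = (z₁ e^{R₁}, z₂ e^{R₂})` (`chartFlow`), and `Φ_t` fixes `z` and changes `ξ` by
`(-R₂ / z₁, R₁ / z₂)` (`groupoidFlow`). Uniqueness of integral curves shows that every flow of `V`
and of `V̂` is of this form.

Let `B = i d log z₁ ∧ d log z₂`. Then `Ω₀ = t^*B - s^*B` (`Omega_eq_target_sub_source`). Since `Φ_t`
preserves the source and covers `φ_t` on the targets, `Φ_t^* Ω₀ = Ω₀ + t^*(φ_t^*B - B)`. The form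
`F = φ_t^*B - B` is real, because `ρ_t` preserves the area (`logForm_chartFlow_sub`), and it
satisfies `I₊ - I₋ = -QF` (`Iplus_sub`). Hence the pullbacks of the Darboux coordinates
`(p, q)` of `Ω₀` by `Φ_t` are Darboux coordinates for `Ω₀ + t^*F` (`isDarbouxOn_flow`).

On the units, `P` and `Q` are elementary functions of `z` and `R`. By conservation of `ham`, the
entropy integrand of the potential is a multiple of the rate at which `R` sweeps out area
(`sum_mul_log_eq_sweep`), so `K` is the function `pot` of `r`. Its differential is found by
differentiating in time (`hasFDerivAt_pot`), and it is `-Re ∑ P_k dQ^k` (`re_eta_eq`). The inverse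
function theorem for `Q` turns this into `P_k = -2 ∂K/∂Q^k` (`isGKPOn_flow`).

Finally the moment map coordinates satisfy the cyclic system `ẏ¹ = y¹ (y² - y³)`, for which
`w = 1/12 - y² y³` solves the differential equation of `℘` (`isCubicSolution_of_cyclic`). On the
half-period line `ω₂ + ℝ` the function `℘` is real, without poles, and solves the same equation. Its
values there fill the interval in which a solution is trapped, so each of the three functions
`1/12 - c₃ / yⁱ` is a translate of `℘` on this line (`IsCubicSolution.exists_shift`). The
translations differ by a third of the period by cyclic symmetry, and the direction in which the
solution runs tells which third (`exists_phase`).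
-/

noncomputable section

namespace GKP

/-! ### Integral curves and the variational equation -/

section

open Set Filter Topology
open scoped Manifold NNReal

variable {E : Type*} [NormedAddCommGroup E] [NormedSpace ℝ E]

theorem isMIntegralCurve_iff_hasDerivAt {v : E → E} {γ : ℝ → E} :
    IsMIntegralCurve (I := 𝓘(ℝ, E)) γ v ↔ ∀ t, HasDerivAt γ (v (γ t)) t := by
  refine forall_congr' fun t => ?_
  have : HasDerivAt γ (v (γ t)) t ↔
    HasFDerivAt γ (ContinuousLinearMap.smulRight (1 : ℝ →L[ℝ] ℝ) (v (γ t))) t :=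
    hasDerivAt_iff_hasFDerivAt
  exact hasMFDerivAt_iff_hasFDerivAt.trans this.symm

theorem contMDiff_section_of_contDiff {v : E → E} (hv : ContDiff ℝ 1 v) :
    ContMDiff 𝓘(ℝ, E) 𝓘(ℝ, E).tangent 1
      (fun x => (⟨x, v x⟩ : TangentBundle 𝓘(ℝ, E) E)) :=
  fun _ => contMDiffAt_vectorSpace_iff_contDiffAt.2 hv.contDiffAt

theorem integralCurve_unique [CompleteSpace E] {v : E → E} (hv : ContDiff ℝ 1 v) {γ γ' : ℝ → E}
    (hγ : ∀ t, HasDerivAt γ (v (γ t)) t) (hγ' : ∀ t, HasDerivAt γ' (v (γ' t)) t) {t₀ : ℝ}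
    (h : γ t₀ = γ' t₀) : γ = γ' :=
  isMIntegralCurve_Ioo_eq_of_contMDiff_boundaryless (I := 𝓘(ℝ, E))
    (contMDiff_section_of_contDiff hv)
    (isMIntegralCurve_iff_hasDerivAt.2 hγ) (isMIntegralCurve_iff_hasDerivAt.2 hγ') h

/-- A `C¹` vector field of at most linear growth is complete. -/
theorem exists_integralCurve_of_linear_growth [FiniteDimensional ℝ E] {v : E → E}
    (hv : ContDiff ℝ 1 v) {K : ℝ} (hK : ∀ x, ‖v x‖ ≤ K * (1 + ‖x‖)) (x : E) :
    ∃ γ : ℝ → E, γ 0 = x ∧ ∀ t, HasDerivAt γ (v (γ t)) t := by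
  have : ProperSpace E := FiniteDimensional.proper ℝ E
  have : CompleteSpace E := FiniteDimensional.complete ℝ E
  wlog hK0 : 0 < K generalizing K
  · exact this (K := max K 1)
      (fun x => (hK x).trans (mul_le_mul_of_nonneg_right (le_max_left _ _) (by positivity)))
      (by positivity)
  -- on the ball of radius `1 + ‖x‖` about `x` the speed is at most `2 K (1 + ‖x‖)`, so that
  -- the time of existence `1 / (2 K)` does not depend on `x`
  have hε : (0 : ℝ) < 1 / (2 * K) := by positivity
  suffices h : ∀ x : E, ∃ γ : ℝ → E, γ 0 = x ∧
      IsMIntegralCurveOn (I := 𝓘(ℝ, E)) γ v (Ioo (-(1 / (2 * K))) (1 / (2 * K))) by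
    obtain ⟨γ, h0, hγ⟩ := exists_isMIntegralCurve_of_isMIntegralCurveOn (I := 𝓘(ℝ, E))
      (contMDiff_section_of_contDiff hv) hε h x
    exact ⟨γ, h0, isMIntegralCurve_iff_hasDerivAt.1 hγ⟩
  intro x
  obtain ⟨C, hC⟩ := (isCompact_closedBall x (1 + ‖x‖)).exists_bound_of_continuousOn
    (hv.continuous_fderiv (by norm_num)).continuousOn
  have hlip : LipschitzOnWith C.toNNReal v (Metric.closedBall x (1 + ‖x‖)) := by
    refine (convex_closedBall x (1 + ‖x‖)).lipschitzOnWith_of_nnnorm_fderiv_le (𝕜 := ℝ)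
      (fun y _ => hv.differentiable (by norm_num) y) fun y hy => ?_
    rw [← NNReal.coe_le_coe, coe_nnnorm]
    exact (hC y hy).trans (Real.le_coe_toNNReal C)
  have hpl : IsPicardLindelof (fun _ => v) (tmin := -(1 / (2 * K))) (tmax := 1 / (2 * K))
      ⟨0, by constructor <;> linarith⟩ x (1 + ‖x‖₊) 0 (2 * K.toNNReal * (1 + ‖x‖₊))
      C.toNNReal := by
    refine IsPicardLindelof.of_time_independent (fun y hy => ?_) hlip ?_
    · have hy' : ‖y‖ ≤ 1 + 2 * ‖x‖ := by
        have := norm_le_norm_add_norm_sub' y x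
        have h2 : ‖y - x‖ ≤ 1 + ‖x‖ := by simpa [dist_eq_norm] using hy
        linarith
      refine (hK y).trans ?_
      push_cast
      rw [Real.coe_toNNReal _ hK0.le]
      have := mul_le_mul_of_nonneg_left hy' hK0.le
      linarith
    · push_cast
      rw [Real.coe_toNNReal _ hK0.le]
      simp only [sub_zero, zero_sub, neg_neg, max_self]
      field_simp; rfl
  obtain ⟨γ, h0, hγ⟩ := hpl.exists_eq_forall_mem_Icc_hasDerivWithinAt₀
  refine ⟨γ, h0, fun t ht => ?_⟩
  refine HasMFDerivAt.hasMFDerivWithinAt ?_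
  have h' : HasDerivAt γ (v (γ t)) t := (hγ t (Ioo_subset_Icc_self ht)).hasDerivAt
    (Icc_mem_nhds ht.1 ht.2)
  exact hasMFDerivAt_iff_hasFDerivAt.2 h'.hasFDerivAt

/-- Grönwall's inequality in both time directions. -/
theorem norm_le_gronwallBound_abs {f f' : ℝ → E} {δ K ε t : ℝ}
    (hf : ∀ t, HasDerivAt f (f' t) t) (h0 : ‖f 0‖ ≤ δ)
    (bound : ∀ s, |s| ≤ |t| → ‖f' s‖ ≤ K * ‖f s‖ + ε) :
    ‖f t‖ ≤ gronwallBound δ K ε |t| := by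
  rcases le_total 0 t with ht | ht
  · have := norm_le_gronwallBound_of_norm_deriv_right_le (a := 0) (b := t)
      (fun s _ => (hf s).continuousAt.continuousWithinAt)
      (fun s _ => (hf s).hasDerivWithinAt) h0
      (fun s hs => bound s (abs_le_abs_of_nonneg hs.1 hs.2.le)) t ⟨ht, le_rfl⟩
    rw [sub_zero] at this
    rwa [abs_of_nonneg ht]
  · have hd : ∀ s, HasDerivAt (fun s => f (-s)) (-f' (-s)) s := fun s => by
      simpa [Function.comp_def] using (hf (-s)).scomp s (hasDerivAt_neg s)
    have := norm_le_gronwallBound_of_norm_deriv_right_le (a := 0) (b := -t)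
      (fun s _ => (hd s).continuousAt.continuousWithinAt)
      (fun s _ => (hd s).hasDerivWithinAt) (by simpa using h0)
      (fun s hs => by
        have := bound (-s) (by rw [abs_neg, ← abs_neg t]; exact abs_le_abs_of_nonneg hs.1 hs.2.le)
        simpa using this) (-t) ⟨by linarith, le_rfl⟩
    rwa [sub_zero, neg_neg, ← abs_of_nonpos ht] at this

theorem norm_le_exp_of_deriv_le {f f' : ℝ → E} {K : ℝ}
    (hf : ∀ t, HasDerivAt f (f' t) t) (bound : ∀ t, ‖f' t‖ ≤ K * ‖f t‖) (t : ℝ) :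
    ‖f t‖ ≤ ‖f 0‖ * Real.exp (K * |t|) := by
  have := norm_le_gronwallBound_abs (ε := 0) (t := t) hf le_rfl
    (fun t _ => by simpa using bound t)
  rwa [gronwallBound_ε0] at this

/-- The Grönwall bound depends monotonically, with a linear constant, on the inhomogeneity. -/
theorem gronwallBound_zero_eq_mul (K ε x : ℝ) :
    gronwallBound 0 K ε x = gronwallBound 0 K 1 x * ε := by
  by_cases hK : K = 0
  · simp [hK, gronwallBound_K0, mul_comm]
  · simp [gronwallBound_of_K_ne_0 hK]; ring

/-- A flow `ρ` of `X` on the whole space, with its variational equation `Y`. -/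
structure IsFlowWithVariation (X : E → E) (ρ : ℝ → E → E) (Y : ℝ → E → E →L[ℝ] E) : Prop where
  flow_zero : ∀ r, ρ 0 r = r
  hasDerivAt_flow : ∀ r t, HasDerivAt (fun s => ρ s r) (X (ρ t r)) t
  variation_zero : ∀ r, Y 0 r = ContinuousLinearMap.id ℝ E
  hasDerivAt_variation : ∀ r t,
    HasDerivAt (fun s => Y s r) ((fderiv ℝ X (ρ t r)).comp (Y t r)) t

/-- The flow and its variational equation are solved together: on `E × (E →L[ℝ] E)` they form a
single `C¹` vector field of linear growth. -/
theorem exists_isFlowWithVariation [FiniteDimensional ℝ E] {X : E → E} (hX : ContDiff ℝ 2 X)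
    {C K : ℝ} (hC : ∀ r, ‖X r‖ ≤ C) (hK : ∀ r, ‖fderiv ℝ X r‖ ≤ K) :
    ∃ ρ Y, IsFlowWithVariation X ρ Y := by
  have hK0 : 0 ≤ K := (norm_nonneg _).trans (hK 0)
  have hC0 : 0 ≤ C := (norm_nonneg _).trans (hC 0)
  have hv : ContDiff ℝ 1
      (fun w : E × (E →L[ℝ] E) => (X w.1, (fderiv ℝ X w.1).comp w.2)) := by
    refine ((hX.of_le (by norm_num)).comp contDiff_fst).prodMk ?_
    exact ((hX.fderiv_right (m := 1) (by norm_num)).comp contDiff_fst).clm_comp contDiff_snd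
  have key := fun r : E => exists_integralCurve_of_linear_growth hv (K := max C K)
    (fun w => by
      refine max_le ?_ ?_
      · refine (hC _).trans ((le_max_left C K).trans ?_)
        exact le_mul_of_one_le_right (hC0.trans (le_max_left _ _)) (by simp)
      · refine (ContinuousLinearMap.opNorm_comp_le _ _).trans ?_
        refine mul_le_mul ((hK _).trans (le_max_right _ _)) ?_ (norm_nonneg _)
          (hC0.trans (le_max_left _ _))
        have : ‖w.2‖ ≤ ‖w‖ := le_max_right _ _
        linarith) (r, ContinuousLinearMap.id ℝ E)
  choose γ h0 hγ using key
  exact ⟨fun t r => (γ r t).1, fun t r => (γ r t).2, fun r => by rw [h0],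
    fun r t => (hγ r t).fst, fun r => by rw [h0], fun r t => (hγ r t).snd⟩

namespace IsFlowWithVariation

variable {X : E → E} {ρ : ℝ → E → E} {Y : ℝ → E → E →L[ℝ] E} {K M : ℝ}

theorem norm_variation_le (h : IsFlowWithVariation X ρ Y) (hK : ∀ r, ‖fderiv ℝ X r‖ ≤ K)
    (t : ℝ) (r : E) : ‖Y t r‖ ≤ Real.exp (K * |t|) := by
  refine (norm_le_exp_of_deriv_le (h.hasDerivAt_variation r) (K := K) (fun t => ?_) t).trans ?_
  · exact (ContinuousLinearMap.opNorm_comp_le _ _).trans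
      (mul_le_mul_of_nonneg_right (hK _) (norm_nonneg _))
  · rw [h.variation_zero]
    exact mul_le_of_le_one_left (Real.exp_pos _).le ContinuousLinearMap.norm_id_le

theorem norm_flow_sub_le (h : IsFlowWithVariation X ρ Y) (hX : Differentiable ℝ X)
    (hK : ∀ r, ‖fderiv ℝ X r‖ ≤ K) (t : ℝ) (r r' : E) :
    ‖ρ t r' - ρ t r‖ ≤ ‖r' - r‖ * Real.exp (K * |t|) := by
  have := norm_le_exp_of_deriv_le (K := K)
    (fun t => (h.hasDerivAt_flow r' t).fun_sub (h.hasDerivAt_flow r t))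
    (fun t => convex_univ.norm_image_sub_le_of_norm_fderiv_le (𝕜 := ℝ) (fun y _ => hX y)
      (fun y _ => hK y) (mem_univ _) (mem_univ _)) t
  simpa [h.flow_zero] using this

/-- The solution of the variational equation is the derivative of the flow: by Grönwall's
inequality the error is quadratic in the displacement. -/
theorem hasFDerivAt_flow (h : IsFlowWithVariation X ρ Y) (hX : Differentiable ℝ X)
    (hK : ∀ r, ‖fderiv ℝ X r‖ ≤ K)
    (hM : ∀ a b, ‖fderiv ℝ X b - fderiv ℝ X a‖ ≤ M * ‖b - a‖) (t : ℝ) (r : E) :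
    HasFDerivAt (ρ t) (Y t r) r := by
  have hK0 : 0 ≤ K := (norm_nonneg _).trans (hK 0)
  have hM0 : 0 ≤ M * ‖r‖ := (norm_nonneg _).trans (by simpa using hM 0 r)
  wlog hM' : 0 ≤ M generalizing M
  · exact this (M := max M 0)
      (fun a b => (hM a b).trans (mul_le_mul_of_nonneg_right (le_max_left _ _) (norm_nonneg _)))
      (by positivity) (le_max_right _ _)
  have taylor : ∀ a b, ‖X b - X a - fderiv ℝ X a (b - a)‖ ≤ M * ‖b - a‖ * ‖b - a‖ := by
    intro a b
    refine (convex_segment a b).norm_image_sub_le_of_norm_hasFDerivWithin_le'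
      (f := X) (f' := fderiv ℝ X) (fun x _ => (hX x).hasFDerivAt.hasFDerivWithinAt)
      (fun x hx => (hM a x).trans ?_) (left_mem_segment ℝ a b) (right_mem_segment ℝ a b)
    exact mul_le_mul_of_nonneg_left (norm_sub_le_of_mem_segment hx) hM'
  set D := gronwallBound 0 K 1 |t| * (M * Real.exp (K * |t|) * Real.exp (K * |t|)) with hD
  have main : ∀ r', ‖ρ t r' - ρ t r - Y t r (r' - r)‖ ≤ D * ‖r' - r‖ ^ 2 := by
    intro r'
    have hd : ∀ s, HasDerivAt (fun s => ρ s r' - ρ s r - Y s r (r' - r))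
        (X (ρ s r') - X (ρ s r) - fderiv ℝ X (ρ s r) (Y s r (r' - r))) s := fun s =>
      ((h.hasDerivAt_flow r' s).fun_sub (h.hasDerivAt_flow r s)).fun_sub
        (((h.hasDerivAt_variation r s).clm_apply (hasDerivAt_const s (r' - r))).congr_deriv
          (by simp))
    refine (norm_le_gronwallBound_abs (t := t) (K := K)
      (ε := M * (‖r' - r‖ * Real.exp (K * |t|)) * (‖r' - r‖ * Real.exp (K * |t|)))
      hd (δ := 0) (by simp [h.flow_zero, h.variation_zero]) fun s hs => ?_).trans_eq ?_
    · have e : X (ρ s r') - X (ρ s r) - fderiv ℝ X (ρ s r) (Y s r (r' - r))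
          = fderiv ℝ X (ρ s r) (ρ s r' - ρ s r - Y s r (r' - r))
            + (X (ρ s r') - X (ρ s r) - fderiv ℝ X (ρ s r) (ρ s r' - ρ s r)) := by
        rw [map_sub (fderiv ℝ X (ρ s r)) (ρ s r' - ρ s r)]; abel
      rw [e]
      have hl : ‖ρ s r' - ρ s r‖ ≤ ‖r' - r‖ * Real.exp (K * |t|) :=
        (h.norm_flow_sub_le hX hK s r r').trans (by gcongr)
      refine (norm_add_le _ _).trans (add_le_add ?_ ((taylor _ _).trans (by gcongr)))
      exact (ContinuousLinearMap.le_opNorm _ _).trans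
        (mul_le_mul_of_nonneg_right (hK _) (norm_nonneg _))
    · rw [gronwallBound_zero_eq_mul, hD]; ring
  refine HasFDerivAt.of_isLittleO ?_
  refine Asymptotics.IsBigO.trans_isLittleO (g := fun r' => ‖r' - r‖ ^ 2) ?_ ?_
  · refine Asymptotics.IsBigO.of_bound D (Eventually.of_forall fun r' => ?_)
    simpa using main r'
  · simpa using Asymptotics.isLittleO_pow_sub_sub r (m := 2) (by norm_num)

theorem continuous_variation (h : IsFlowWithVariation X ρ Y) (hX : Differentiable ℝ X)
    (hK : ∀ r, ‖fderiv ℝ X r‖ ≤ K)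
    (hM : ∀ a b, ‖fderiv ℝ X b - fderiv ℝ X a‖ ≤ M * ‖b - a‖) (t : ℝ) :
    Continuous (Y t) := by
  have main : ∀ r r', ‖Y t r' - Y t r‖ ≤
      gronwallBound 0 K 1 |t| * (M * Real.exp (K * |t|) * Real.exp (K * |t|)) * ‖r' - r‖ := by
    intro r r'
    have hM0 : 0 ≤ M * ‖r' - r‖ := (norm_nonneg _).trans (hM r r')
    have hK0 : 0 ≤ K := (norm_nonneg _).trans (hK 0)
    refine (norm_le_gronwallBound_abs (t := t) (K := K)
      (ε := M * ‖r' - r‖ * Real.exp (K * |t|) * Real.exp (K * |t|))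
      (fun s => (h.hasDerivAt_variation r' s).fun_sub (h.hasDerivAt_variation r s))
      (δ := 0) (by simp [h.variation_zero]) fun s hs => ?_).trans_eq ?_
    · have e : (fderiv ℝ X (ρ s r')).comp (Y s r') - (fderiv ℝ X (ρ s r)).comp (Y s r)
          = (fderiv ℝ X (ρ s r)).comp (Y s r' - Y s r)
            + (fderiv ℝ X (ρ s r') - fderiv ℝ X (ρ s r)).comp (Y s r') := by
        rw [ContinuousLinearMap.comp_sub, ContinuousLinearMap.sub_comp]; abel
      rw [e]
      refine (norm_add_le _ _).trans (add_le_add ?_ ?_)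
      · exact (ContinuousLinearMap.opNorm_comp_le _ _).trans
          (mul_le_mul_of_nonneg_right (hK _) (norm_nonneg _))
      · refine (ContinuousLinearMap.opNorm_comp_le _ _).trans (mul_le_mul ?_
          ((h.norm_variation_le hK s r').trans (by gcongr)) (norm_nonneg _) (by positivity))
        by_cases hM1 : 0 ≤ M
        · refine (hM _ _).trans ?_
          rw [mul_assoc]
          exact mul_le_mul_of_nonneg_left
            ((h.norm_flow_sub_le hX hK s r r').trans (by gcongr)) hM1
        · have hz : ρ s r' - ρ s r = 0 := by
            have := (norm_nonneg _).trans (hM (ρ s r) (ρ s r'))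
            rw [← norm_eq_zero]
            nlinarith [norm_nonneg (ρ s r' - ρ s r)]
          refine (hM _ _).trans ?_
          rw [hz, norm_zero, mul_zero]
          positivity
    · rw [gronwallBound_zero_eq_mul]; ring
  refine continuous_iff_continuousAt.2 fun r => ?_
  refine tendsto_iff_norm_sub_tendsto_zero.2 (squeeze_zero (fun _ => norm_nonneg _)
    (fun r' => main r r') ?_)
  have : Continuous fun r' => gronwallBound 0 K 1 |t| *
      (M * Real.exp (K * |t|) * Real.exp (K * |t|)) * ‖r' - r‖ := by fun_prop
  simpa using this.tendsto r

end IsFlowWithVariation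

end

/-! ### The Hamiltonian system on the plane of logarithmic coordinates -/

section

open Set Filter Topology MeasureTheory

/-- The moment map coordinate `y¹` as a function of `r = (log |z₁|, log |z₂|)`. -/
def m₁ (r : ℝ × ℝ) : ℝ :=
  Real.exp (2 * r.1) / (1 + Real.exp (2 * r.1) + Real.exp (2 * r.2))

/-- The moment map coordinate `y²` as a function of `r = (log |z₁|, log |z₂|)`. -/
def m₂ (r : ℝ × ℝ) : ℝ :=
  Real.exp (2 * r.2) / (1 + Real.exp (2 * r.1) + Real.exp (2 * r.2))

/-- The Hamiltonian `h = -¼ log (y¹ y² y³)` as a function of `r = (log |z₁|, log |z₂|)`. -/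
def ham (r : ℝ × ℝ) : ℝ :=
  -(1 / 4) * (2 * r.1 + 2 * r.2 - 3 * Real.log (1 + Real.exp (2 * r.1) + Real.exp (2 * r.2)))

/-- The vector field `V` in the coordinates `r = (log |z₁|, log |z₂|)`: it is the Hamiltonian
vector field `(∂h/∂r₂, -∂h/∂r₁)`. -/
def field (r : ℝ × ℝ) : ℝ × ℝ := ((3 * m₂ r - 1) / 2, (1 - 3 * m₁ r) / 2)

/-- The derivative of `field`; it has trace zero. -/
def fieldDeriv (r : ℝ × ℝ) : ℝ × ℝ →L[ℝ] ℝ × ℝ :=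
  ((-3 * (m₁ r * m₂ r)) • ContinuousLinearMap.fst ℝ ℝ ℝ
      + (3 * (m₂ r * (1 - m₂ r))) • ContinuousLinearMap.snd ℝ ℝ ℝ).prod
    ((-3 * (m₁ r * (1 - m₁ r))) • ContinuousLinearMap.fst ℝ ℝ ℝ
      + (3 * (m₁ r * m₂ r)) • ContinuousLinearMap.snd ℝ ℝ ℝ)

theorem m₁_pos (r : ℝ × ℝ) : 0 < m₁ r := by unfold m₁; positivity

theorem m₂_pos (r : ℝ × ℝ) : 0 < m₂ r := by unfold m₂; positivity

theorem one_sub_m₁_sub_m₂ (r : ℝ × ℝ) :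
    1 - m₁ r - m₂ r = 1 / (1 + Real.exp (2 * r.1) + Real.exp (2 * r.2)) := by
  have : 0 < 1 + Real.exp (2 * r.1) + Real.exp (2 * r.2) := by positivity
  unfold m₁ m₂; field_simp; ring

theorem m₁_add_m₂_lt_one (r : ℝ × ℝ) : m₁ r + m₂ r < 1 := by
  have := one_sub_m₁_sub_m₂ r
  have h : 0 < 1 / (1 + Real.exp (2 * r.1) + Real.exp (2 * r.2)) := by positivity
  linarith

theorem hasFDerivAt_exp_two_mul_fst (r : ℝ × ℝ) : HasFDerivAt (fun r : ℝ × ℝ => Real.exp (2 * r.1))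
    ((2 * Real.exp (2 * r.1)) • ContinuousLinearMap.fst ℝ ℝ ℝ) r := by
  refine ((hasFDerivAt_fst (𝕜 := ℝ) (p := r)).const_mul 2).exp.congr_fderiv ?_
  ext <;> simp <;> ring

theorem hasFDerivAt_exp_two_mul_snd (r : ℝ × ℝ) : HasFDerivAt (fun r : ℝ × ℝ => Real.exp (2 * r.2))
    ((2 * Real.exp (2 * r.2)) • ContinuousLinearMap.snd ℝ ℝ ℝ) r := by
  refine ((hasFDerivAt_snd (𝕜 := ℝ) (p := r)).const_mul 2).exp.congr_fderiv ?_
  ext <;> simp <;> ring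

theorem hasFDerivAt_one_add_exp_add_exp (r : ℝ × ℝ) :
    HasFDerivAt (fun r : ℝ × ℝ => 1 + Real.exp (2 * r.1) + Real.exp (2 * r.2))
      ((2 * Real.exp (2 * r.1)) • ContinuousLinearMap.fst ℝ ℝ ℝ
        + (2 * Real.exp (2 * r.2)) • ContinuousLinearMap.snd ℝ ℝ ℝ) r :=
  ((hasFDerivAt_exp_two_mul_fst r).const_add 1).add (hasFDerivAt_exp_two_mul_snd r)

theorem hasFDerivAt_m₁ (r : ℝ × ℝ) : HasFDerivAt m₁
    ((2 * (m₁ r * (1 - m₁ r))) • ContinuousLinearMap.fst ℝ ℝ ℝ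
      - (2 * (m₁ r * m₂ r)) • ContinuousLinearMap.snd ℝ ℝ ℝ) r := by
  have hS : 1 + Real.exp (2 * r.1) + Real.exp (2 * r.2) ≠ 0 := by positivity
  refine ((hasFDerivAt_exp_two_mul_fst r).mul
    ((hasDerivAt_inv hS).comp_hasFDerivAt r (hasFDerivAt_one_add_exp_add_exp r))).congr_fderiv ?_
    |>.congr_of_eventuallyEq (Eventually.of_forall fun r => div_eq_mul_inv _ _)
  ext <;> simp [m₁, m₂] <;> field_simp <;> ring

theorem hasFDerivAt_m₂ (r : ℝ × ℝ) : HasFDerivAt m₂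
    ((-2 * (m₁ r * m₂ r)) • ContinuousLinearMap.fst ℝ ℝ ℝ
      + (2 * (m₂ r * (1 - m₂ r))) • ContinuousLinearMap.snd ℝ ℝ ℝ) r := by
  have hS : 1 + Real.exp (2 * r.1) + Real.exp (2 * r.2) ≠ 0 := by positivity
  refine ((hasFDerivAt_exp_two_mul_snd r).mul
    ((hasDerivAt_inv hS).comp_hasFDerivAt r (hasFDerivAt_one_add_exp_add_exp r))).congr_fderiv ?_
    |>.congr_of_eventuallyEq (Eventually.of_forall fun r => div_eq_mul_inv _ _)
  ext <;> simp [m₁, m₂] <;> field_simp <;> ring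

theorem hasFDerivAt_ham (r : ℝ × ℝ) : HasFDerivAt ham
    (-(field r).2 • ContinuousLinearMap.fst ℝ ℝ ℝ
      + (field r).1 • ContinuousLinearMap.snd ℝ ℝ ℝ) r := by
  have hS : 1 + Real.exp (2 * r.1) + Real.exp (2 * r.2) ≠ 0 := by positivity
  refine ((((hasFDerivAt_fst (𝕜 := ℝ) (p := r)).const_mul 2).add
    ((hasFDerivAt_snd (𝕜 := ℝ) (p := r)).const_mul 2)).fun_sub
    (((hasFDerivAt_one_add_exp_add_exp r).log hS).const_mul 3)).const_mul (-(1 / 4))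
    |>.congr_fderiv ?_
  ext <;> simp [m₁, m₂, field] <;> field_simp <;> ring

theorem hasFDerivAt_field (r : ℝ × ℝ) : HasFDerivAt field (fieldDeriv r) r := by
  refine (((((hasFDerivAt_m₂ r).const_mul 3).sub_const 1).mul_const (1 / 2)).prodMk
    ((((hasFDerivAt_m₁ r).const_mul 3).const_sub 1).mul_const (1 / 2))).congr_fderiv ?_
    |>.congr_of_eventuallyEq (Eventually.of_forall fun r => ?_)
  · ext <;> simp [fieldDeriv] <;> ring
  · simp [field, div_eq_mul_inv]

theorem fderiv_field (r : ℝ × ℝ) : fderiv ℝ field r = fieldDeriv r := (hasFDerivAt_field r).fderiv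

theorem contDiff_field : ContDiff ℝ 2 field := by
  have hS : ∀ r : ℝ × ℝ, 1 + Real.exp (2 * r.1) + Real.exp (2 * r.2) ≠ 0 := fun r => by positivity
  unfold field m₁ m₂
  fun_prop (disch := intros; apply hS)

theorem norm_field_le (r : ℝ × ℝ) : ‖field r‖ ≤ 2 := by
  have h1 := m₁_pos r; have h2 := m₂_pos r; have h3 := m₁_add_m₂_lt_one r
  refine max_le ?_ ?_ <;> simp only [field, Real.norm_eq_abs] <;> rw [abs_le] <;>
    constructor <;> linarith

/-- A bound for the operator norm of a linear map of the plane, with the maximum norm, in terms of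
bounds for its matrix entries. -/
theorem opNorm_prod_le {a b c d B : ℝ} (ha : |a| ≤ B) (hb : |b| ≤ B) (hc : |c| ≤ B)
    (hd : |d| ≤ B) :
    ‖(a • ContinuousLinearMap.fst ℝ ℝ ℝ + b • ContinuousLinearMap.snd ℝ ℝ ℝ).prod
      (c • ContinuousLinearMap.fst ℝ ℝ ℝ + d • ContinuousLinearMap.snd ℝ ℝ ℝ)‖ ≤ 2 * B := by
  have hB : 0 ≤ B := (abs_nonneg a).trans ha
  refine ContinuousLinearMap.opNorm_le_bound _ (by positivity) fun v => ?_
  have h1 : |v.1| ≤ ‖v‖ := norm_fst_le v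
  have h2 : |v.2| ≤ ‖v‖ := norm_snd_le v
  have key : ∀ a b : ℝ, |a| ≤ B → |b| ≤ B → |a * v.1 + b * v.2| ≤ 2 * B * ‖v‖ := by
    intro a b ha hb
    calc |a * v.1 + b * v.2| ≤ |a| * |v.1| + |b| * |v.2| := by
          rw [← abs_mul, ← abs_mul]; exact abs_add_le _ _
      _ ≤ B * ‖v‖ + B * ‖v‖ := by gcongr
      _ = 2 * B * ‖v‖ := by ring
  exact max_le (by simpa using key a b ha hb) (by simpa using key c d hc hd)

theorem norm_fderiv_field_le (r : ℝ × ℝ) : ‖fderiv ℝ field r‖ ≤ 2 * 3 := by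
  have h1 := m₁_pos r; have h2 := m₂_pos r; have h3 := m₁_add_m₂_lt_one r
  rw [fderiv_field]
  refine opNorm_prod_le ?_ ?_ ?_ ?_ <;> rw [abs_le] <;> constructor <;> nlinarith

theorem abs_m₁_sub_le (a b : ℝ × ℝ) : |m₁ b - m₁ a| ≤ 4 * ‖b - a‖ := by
  refine convex_univ.norm_image_sub_le_of_norm_hasFDerivWithin_le
    (fun r _ => (hasFDerivAt_m₁ r).hasFDerivWithinAt) (fun r _ => ?_) (mem_univ a) (mem_univ b)
  have h1 := m₁_pos r; have h2 := m₂_pos r; have h3 := m₁_add_m₂_lt_one r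
  refine ContinuousLinearMap.opNorm_le_bound _ (by norm_num) fun v => ?_
  have hv1 : |v.1| ≤ ‖v‖ := norm_fst_le v
  have hv2 : |v.2| ≤ ‖v‖ := norm_snd_le v
  rw [abs_le] at hv1 hv2
  simp only [sub_apply, smul_apply,
    ContinuousLinearMap.coe_fst', ContinuousLinearMap.coe_snd', smul_eq_mul, Real.norm_eq_abs]
  have e1 : 0 ≤ 2 * (m₁ r * (1 - m₁ r)) := by nlinarith
  have e1' : 2 * (m₁ r * (1 - m₁ r)) ≤ 2 := by nlinarith
  have e2 : 0 ≤ 2 * (m₁ r * m₂ r) := by positivity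
  have e2' : 2 * (m₁ r * m₂ r) ≤ 2 := by nlinarith
  rw [abs_le]; constructor <;> nlinarith

theorem abs_m₂_sub_le (a b : ℝ × ℝ) : |m₂ b - m₂ a| ≤ 4 * ‖b - a‖ := by
  -- exchanging the two coordinates exchanges `m₁` and `m₂`
  have e : ∀ r : ℝ × ℝ, m₂ r = m₁ r.swap := fun r => by simp [m₁, m₂, add_right_comm]
  rw [e, e]
  refine (abs_m₁_sub_le _ _).trans_eq ?_
  rw [← Prod.swap_sub, Prod.norm_def, Prod.norm_def, max_comm]; rfl

theorem norm_fderiv_field_sub_le (a b : ℝ × ℝ) :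
    ‖fderiv ℝ field b - fderiv ℝ field a‖ ≤ 2 * 36 * ‖b - a‖ := by
  have h1 := m₁_pos a; have h2 := m₂_pos a; have h3 := m₁_add_m₂_lt_one a
  have k1 := m₁_pos b; have k2 := m₂_pos b; have k3 := m₁_add_m₂_lt_one b
  have e1 := abs_m₁_sub_le a b
  have e2 := abs_m₂_sub_le a b
  have hN := norm_nonneg (b - a)
  rw [fderiv_field, fderiv_field, mul_assoc]
  have hp : |m₁ b * m₂ b - m₁ a * m₂ a| ≤ 8 * ‖b - a‖ := by
    rw [abs_le] at *
    constructor <;> nlinarith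
  have hq : ∀ {x y : ℝ}, 0 < x → x < 1 → 0 < y → y < 1 → |x - y| ≤ 4 * ‖b - a‖ →
      |x * (1 - x) - y * (1 - y)| ≤ 12 * ‖b - a‖ := by
    intro x y hx hx' hy hy' h
    rw [show x * (1 - x) - y * (1 - y) = (x - y) * (1 - x - y) by ring, abs_mul]
    have : |1 - x - y| ≤ 1 := by rw [abs_le]; constructor <;> linarith
    nlinarith [abs_nonneg (x - y)]
  have hq1 := hq k1 (by linarith) h1 (by linarith) e1
  have hq2 := hq k2 (by linarith) h2 (by linarith) e2
  refine (le_of_eq ?_).trans (opNorm_prod_le (a := -3 * (m₁ b * m₂ b - m₁ a * m₂ a))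
    (b := 3 * (m₂ b * (1 - m₂ b) - m₂ a * (1 - m₂ a)))
    (c := -3 * (m₁ b * (1 - m₁ b) - m₁ a * (1 - m₁ a)))
    (d := 3 * (m₁ b * m₂ b - m₁ a * m₂ a)) ?_ ?_ ?_ ?_)
  · congr 1
    ext <;> simp [fieldDeriv] <;> ring
  all_goals
    rw [abs_mul]; norm_num; linarith

end

/-! ### The planar flow and the potential -/

section

open Set Filter Topology MeasureTheory

theorem hasDerivAt_fst_comp {f : ℝ → ℝ × ℝ} {f' : ℝ × ℝ} {t : ℝ} (h : HasDerivAt f f' t) :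
    HasDerivAt (fun s => (f s).1) f'.1 t :=
  (hasFDerivAt_fst (𝕜 := ℝ) (p := f t)).comp_hasDerivAt t h

theorem hasDerivAt_snd_comp {f : ℝ → ℝ × ℝ} {f' : ℝ × ℝ} {t : ℝ} (h : HasDerivAt f f' t) :
    HasDerivAt (fun s => (f s).2) f'.2 t :=
  (hasFDerivAt_snd (𝕜 := ℝ) (p := f t)).comp_hasDerivAt t h

theorem exists_isFlowWithVariation_field : ∃ ρ Y, IsFlowWithVariation field ρ Y :=
  exists_isFlowWithVariation contDiff_field norm_field_le norm_fderiv_field_le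

/-- The flow `ρ_t` of `field` on the plane. -/
def flow : ℝ → ℝ × ℝ → ℝ × ℝ := exists_isFlowWithVariation_field.choose

/-- The derivative `Dρ_t` of the flow of `field`. -/
def var : ℝ → ℝ × ℝ → ℝ × ℝ →L[ℝ] ℝ × ℝ := exists_isFlowWithVariation_field.choose_spec.choose

theorem isFlowWithVariation_flow : IsFlowWithVariation field flow var :=
  exists_isFlowWithVariation_field.choose_spec.choose_spec

theorem flow_zero (r : ℝ × ℝ) : flow 0 r = r := isFlowWithVariation_flow.flow_zero r

theorem hasDerivAt_flow (r : ℝ × ℝ) (t : ℝ) : HasDerivAt (fun s => flow s r) (field (flow t r)) t :=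
  isFlowWithVariation_flow.hasDerivAt_flow r t

theorem var_zero (r : ℝ × ℝ) : var 0 r = ContinuousLinearMap.id ℝ (ℝ × ℝ) :=
  isFlowWithVariation_flow.variation_zero r

theorem hasDerivAt_var (r : ℝ × ℝ) (t : ℝ) :
    HasDerivAt (fun s => var s r) ((fieldDeriv (flow t r)).comp (var t r)) t := by
  rw [← fderiv_field]
  exact isFlowWithVariation_flow.hasDerivAt_variation r t

theorem hasFDerivAt_flow (t : ℝ) (r : ℝ × ℝ) : HasFDerivAt (flow t) (var t r) r :=
  isFlowWithVariation_flow.hasFDerivAt_flow (contDiff_field.differentiable (by norm_num))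
    norm_fderiv_field_le norm_fderiv_field_sub_le t r

theorem continuous_var (t : ℝ) : Continuous (var t) :=
  isFlowWithVariation_flow.continuous_variation (contDiff_field.differentiable (by norm_num))
    norm_fderiv_field_le norm_fderiv_field_sub_le t

theorem norm_var_le (t : ℝ) (r : ℝ × ℝ) : ‖var t r‖ ≤ Real.exp (6 * |t|) := by
  have := isFlowWithVariation_flow.norm_variation_le norm_fderiv_field_le t r
  norm_num at this ⊢
  exact this

theorem continuous_flow_time (r : ℝ × ℝ) : Continuous fun s => flow s r :=
  continuous_iff_continuousAt.2 fun t => (hasDerivAt_flow r t).continuousAt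

theorem continuous_var_time (r : ℝ × ℝ) : Continuous fun s => var s r :=
  continuous_iff_continuousAt.2 fun t => (hasDerivAt_var r t).continuousAt

/-- The flow of `field` preserves its Hamiltonian. -/
theorem ham_flow (t : ℝ) (r : ℝ × ℝ) : ham (flow t r) = ham r := by
  have h : ∀ s, HasDerivAt (fun s => ham (flow s r)) 0 s := fun s => by
    refine ((hasFDerivAt_ham (flow s r)).comp_hasDerivAt s (hasDerivAt_flow r s)).congr_deriv ?_
    simp; ring
  have := is_const_of_deriv_eq_zero (fun s => (h s).differentiableAt) (fun s => (h s).deriv) t 0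
  simpa [flow_zero] using this

/-- The flow of `field` preserves the area, since `field` is divergence free. -/
theorem det_var (t : ℝ) (r : ℝ × ℝ) :
    (var t r (1, 0)).1 * (var t r (0, 1)).2 - (var t r (1, 0)).2 * (var t r (0, 1)).1 = 1 := by
  have hv : ∀ (v : ℝ × ℝ) s, HasDerivAt (fun s => var s r v)
      (fieldDeriv (flow s r) (var s r v)) s := fun v s =>
    ((hasDerivAt_var r s).clm_apply (hasDerivAt_const s v)).congr_deriv (by simp)
  have h : ∀ s, HasDerivAt (fun s => (var s r (1, 0)).1 * (var s r (0, 1)).2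
      - (var s r (1, 0)).2 * (var s r (0, 1)).1) 0 s := fun s => by
    refine (((hasDerivAt_fst_comp (hv (1, 0) s)).fun_mul
      (hasDerivAt_snd_comp (hv (0, 1) s))).fun_sub ((hasDerivAt_snd_comp (hv (1, 0) s)).fun_mul
      (hasDerivAt_fst_comp (hv (0, 1) s)))).congr_deriv ?_
    simp [fieldDeriv]; ring
  have := is_const_of_deriv_eq_zero (fun s => (h s).differentiableAt) (fun s => (h s).deriv) t 0
  simpa [var_zero] using this

/-- The displacement `R_t(r) = ρ_t(r) - r` of the flow. -/
def disp (t : ℝ) (r : ℝ × ℝ) : ℝ × ℝ := flow t r - r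

/-- The derivative of the displacement. -/
def dispDeriv (t : ℝ) (r : ℝ × ℝ) : ℝ × ℝ →L[ℝ] ℝ × ℝ :=
  var t r - ContinuousLinearMap.id ℝ (ℝ × ℝ)

theorem disp_zero (r : ℝ × ℝ) : disp 0 r = 0 := by simp [disp, flow_zero]

theorem hasDerivAt_disp (r : ℝ × ℝ) (t : ℝ) :
    HasDerivAt (fun s => disp s r) (field (flow t r)) t :=
  (hasDerivAt_flow r t).sub_const r

theorem hasFDerivAt_disp (t : ℝ) (r : ℝ × ℝ) : HasFDerivAt (disp t) (dispDeriv t r) r :=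
  (hasFDerivAt_flow t r).sub (hasFDerivAt_id r)

theorem hasDerivAt_dispDeriv (r : ℝ × ℝ) (t : ℝ) (v : ℝ × ℝ) :
    HasDerivAt (fun s => dispDeriv s r v) (fieldDeriv (flow t r) (var t r v)) t :=
  (((hasDerivAt_var r t).clm_apply (hasDerivAt_const t v)).sub_const v).congr_deriv (by simp)

theorem continuous_dispDeriv (t : ℝ) : Continuous (dispDeriv t) :=
  (continuous_var t).sub continuous_const

theorem contDiff_disp (t : ℝ) : ContDiff ℝ 1 (disp t) :=
  contDiff_one_iff_hasFDerivAt.2 ⟨_, continuous_dispDeriv t, hasFDerivAt_disp t⟩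

theorem norm_disp_le (t : ℝ) (r : ℝ × ℝ) : ‖disp t r‖ ≤ 2 * |t| := by
  have := convex_univ.norm_image_sub_le_of_norm_hasDerivWithin_le (C := 2)
    (fun s _ => (hasDerivAt_disp r s).hasDerivWithinAt) (fun s _ => norm_field_le _)
    (mem_univ 0) (mem_univ t)
  simpa [disp_zero] using this

/-- The integrand of the potential: minus half of it is the rate at which the displacement
vector sweeps out area. -/
def sweep (s : ℝ) (r : ℝ × ℝ) : ℝ :=
  (disp s r).2 * (field (flow s r)).1 - (disp s r).1 * (field (flow s r)).2

/-- The derivative of `sweep` in the initial point. -/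
def sweepDeriv (s : ℝ) (r : ℝ × ℝ) : ℝ × ℝ →L[ℝ] ℝ :=
  (disp s r).2 • (ContinuousLinearMap.fst ℝ ℝ ℝ).comp ((fieldDeriv (flow s r)).comp (var s r))
    + (field (flow s r)).1 • (ContinuousLinearMap.snd ℝ ℝ ℝ).comp (dispDeriv s r)
    - ((disp s r).1 • (ContinuousLinearMap.snd ℝ ℝ ℝ).comp ((fieldDeriv (flow s r)).comp (var s r))
      + (field (flow s r)).2 • (ContinuousLinearMap.fst ℝ ℝ ℝ).comp (dispDeriv s r))

theorem hasFDerivAt_sweep (s : ℝ) (r : ℝ × ℝ) : HasFDerivAt (sweep s) (sweepDeriv s r) r := by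
  have h1 := hasFDerivAt_disp s r
  have h2 := (hasFDerivAt_field (flow s r)).comp r (hasFDerivAt_flow s r)
  exact (h1.snd.mul h2.fst).sub (h1.fst.mul h2.snd)

theorem continuous_fieldDeriv : Continuous fieldDeriv := by
  have : fieldDeriv = fderiv ℝ field := funext fun r => (fderiv_field r).symm
  rw [this]
  exact contDiff_field.continuous_fderiv (by norm_num)

theorem continuous_disp_time (r : ℝ × ℝ) : Continuous fun s => disp s r :=
  (continuous_flow_time r).sub continuous_const

theorem continuous_sweep_time (r : ℝ × ℝ) : Continuous fun s => sweep s r := by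
  have h1 := continuous_disp_time r
  have h2 := contDiff_field.continuous.comp (continuous_flow_time r)
  exact (h1.snd.mul h2.fst).sub (h1.fst.mul h2.snd)

theorem continuous_sweepDeriv_time (r : ℝ × ℝ) : Continuous fun s => sweepDeriv s r := by
  have h1 := continuous_disp_time r
  have h2 := contDiff_field.continuous.comp (continuous_flow_time r)
  have h3 := (continuous_fieldDeriv.comp (continuous_flow_time r)).clm_comp (continuous_var_time r)
  have h4 : Continuous fun s => dispDeriv s r := (continuous_var_time r).sub continuous_const
  exact ((h1.snd.smul (continuous_const.clm_comp h3)).add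
    (h2.fst.smul (continuous_const.clm_comp h4))).sub
    ((h1.fst.smul (continuous_const.clm_comp h3)).add
    (h2.snd.smul (continuous_const.clm_comp h4)))

theorem norm_sweepDeriv_le {s t : ℝ} (hs : |s| ≤ |t|) (r : ℝ × ℝ) :
    ‖sweepDeriv s r‖ ≤ 24 * |t| * Real.exp (6 * |t|) + 4 * (Real.exp (6 * |t|) + 1) := by
  have hd : ‖disp s r‖ ≤ 2 * |t| := (norm_disp_le s r).trans (by linarith)
  have hv : ‖var s r‖ ≤ Real.exp (6 * |t|) := (norm_var_le s r).trans (by gcongr)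
  have hc : ‖(fieldDeriv (flow s r)).comp (var s r)‖ ≤ 6 * Real.exp (6 * |t|) := by
    refine (ContinuousLinearMap.opNorm_comp_le _ _).trans (mul_le_mul ?_ hv (norm_nonneg _)
      (by norm_num))
    have := norm_fderiv_field_le (flow s r)
    rw [fderiv_field] at this; linarith
  have hD : ‖dispDeriv s r‖ ≤ Real.exp (6 * |t|) + 1 :=
    (norm_sub_le _ _).trans (add_le_add hv ContinuousLinearMap.norm_id_le)
  have hf := norm_field_le (flow s r)
  have key : ∀ (a B C : ℝ) (l : ℝ × ℝ →L[ℝ] ℝ) (T : ℝ × ℝ →L[ℝ] ℝ × ℝ), |a| ≤ B → ‖l‖ ≤ 1 →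
      ‖T‖ ≤ C → ‖a • l.comp T‖ ≤ B * C := fun a B C l T ha hl hT => by
    rw [norm_smul, Real.norm_eq_abs]
    refine mul_le_mul ha ?_ (norm_nonneg _) ((abs_nonneg a).trans ha)
    exact (ContinuousLinearMap.opNorm_comp_le _ _).trans
      ((mul_le_mul hl hT (norm_nonneg _) zero_le_one).trans (one_mul C).le)
  have n1 : ‖ContinuousLinearMap.fst ℝ ℝ ℝ‖ ≤ 1 := ContinuousLinearMap.norm_fst_le ..
  have n2 : ‖ContinuousLinearMap.snd ℝ ℝ ℝ‖ ≤ 1 := ContinuousLinearMap.norm_snd_le ..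
  have k1 := key _ _ _ _ _ ((norm_snd_le (disp s r)).trans hd) n1 hc
  have k2 := key _ _ _ _ _ ((norm_fst_le (field (flow s r))).trans hf) n2 hD
  have k3 := key _ _ _ _ _ ((norm_fst_le (disp s r)).trans hd) n2 hc
  have k4 := key _ _ _ _ _ ((norm_snd_le (field (flow s r))).trans hf) n1 hD
  refine (norm_sub_le _ _).trans (((add_le_add (norm_add_le _ _) (norm_add_le _ _)).trans
    (add_le_add (add_le_add k1 k2) (add_le_add k3 k4))).trans (le_of_eq ?_))
  ring

/-- The generalised Kähler potential as a function of `r = (log |z₁|, log |z₂|)`. -/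
def pot (t : ℝ) (r : ℝ × ℝ) : ℝ := -t * ham r + 1 / 2 * ∫ s in (0 : ℝ)..t, sweep s r

/-- The differential of the potential. -/
def potDeriv (t : ℝ) (r : ℝ × ℝ) : ℝ × ℝ →L[ℝ] ℝ :=
  (disp t r).2 • ContinuousLinearMap.fst ℝ ℝ ℝ - (disp t r).1 • ContinuousLinearMap.snd ℝ ℝ ℝ
    - (1 / 2 : ℝ) • ((disp t r).1 • (ContinuousLinearMap.snd ℝ ℝ ℝ).comp (dispDeriv t r)
      - (disp t r).2 • (ContinuousLinearMap.fst ℝ ℝ ℝ).comp (dispDeriv t r))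

/-- The time derivative of `potDeriv` is the differential of the time derivative of `pot`; the
term with the Hamiltonian uses that `h ∘ ρ_t = h`. -/
theorem hasDerivAt_potDeriv (r v : ℝ × ℝ) (t : ℝ) :
    HasDerivAt (fun s => potDeriv s r v)
      ((field r).2 * v.1 - (field r).1 * v.2 + 1 / 2 * sweepDeriv t r v) t := by
  have hR1 := hasDerivAt_fst_comp (hasDerivAt_disp r t)
  have hR2 := hasDerivAt_snd_comp (hasDerivAt_disp r t)
  have hD1 := hasDerivAt_fst_comp (hasDerivAt_dispDeriv r t v)
  have hD2 := hasDerivAt_snd_comp (hasDerivAt_dispDeriv r t v)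
  have hH : -(field (flow t r)).2 * (var t r v).1 + (field (flow t r)).1 * (var t r v).2
      = -(field r).2 * v.1 + (field r).1 * v.2 := by
    have h1 := (hasFDerivAt_ham (flow t r)).comp r (hasFDerivAt_flow t r)
    have h2 : ham ∘ flow t = ham := funext (ham_flow t)
    rw [h2] at h1
    simpa using congrArg (fun l => l v) (h1.unique (hasFDerivAt_ham r))
  have hV : dispDeriv t r v = var t r v - v := rfl
  refine (((hR2.mul_const v.1).fun_sub (hR1.mul_const v.2)).fun_sub
    (((hR1.fun_mul hD2).fun_sub (hR2.fun_mul hD1)).const_mul (1 / 2))).congr_deriv ?_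
    |>.congr_of_eventuallyEq (Eventually.of_forall fun s => ?_)
  · simp only [sweepDeriv, sub_apply, add_apply, smul_apply, smul_eq_mul,
      ContinuousLinearMap.comp_apply, ContinuousLinearMap.coe_fst', ContinuousLinearMap.coe_snd',
      hV, Prod.fst_sub, Prod.snd_sub]
    linear_combination -hH
  · simp [potDeriv]

theorem hasFDerivAt_pot (t : ℝ) (r : ℝ × ℝ) : HasFDerivAt (pot t) (potDeriv t r) r := by
  have hint := (intervalIntegral.hasFDerivAt_integral_of_dominated_of_fderiv_le (μ := volume)
    (F := fun r s => sweep s r) (F' := fun r s => sweepDeriv s r) (x₀ := r) (a := 0) (b := t)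
    (bound := fun _ => 24 * |t| * Real.exp (6 * |t|) + 4 * (Real.exp (6 * |t|) + 1))
    (s := univ) univ_mem
    (Eventually.of_forall fun r => (continuous_sweep_time r).aestronglyMeasurable)
    ((continuous_sweep_time r).intervalIntegrable _ _)
    (continuous_sweepDeriv_time r).aestronglyMeasurable
    (Eventually.of_forall fun s hs r _ => norm_sweepDeriv_le (by
      have := abs_sub_left_of_mem_uIcc (uIoc_subset_uIcc hs)
      simpa using this) r)
    intervalIntegrable_const
    (Eventually.of_forall fun s _ r _ => hasFDerivAt_sweep s r))
  refine (((hasFDerivAt_ham r).const_mul (-t)).add (hint.const_mul (1 / 2))).congr_fderiv ?_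
  refine ContinuousLinearMap.ext fun v => ?_
  have hcont : Continuous fun s => 1 / 2 * sweepDeriv s r v := continuous_const.mul
    ((continuous_sweepDeriv_time r).clm_apply continuous_const)
  have hftc := intervalIntegral.integral_eq_sub_of_hasDerivAt (a := 0) (b := t)
    (fun s _ => hasDerivAt_potDeriv r v s) ((continuous_const.add hcont).intervalIntegrable _ _)
  have h0 : potDeriv 0 r v = 0 := by simp [potDeriv, disp_zero]
  have hi := ContinuousLinearMap.intervalIntegral_apply
    ((continuous_sweepDeriv_time r).intervalIntegrable (μ := volume) 0 t) v
  rw [h0, sub_zero, intervalIntegral.integral_add intervalIntegrable_const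
    (hcont.intervalIntegrable _ _),
    intervalIntegral.integral_const_mul, ← hi] at hftc
  rw [← hftc]
  simp
  ring

end

/-! ### The Weierstrass function of a rectangular lattice -/

section

open Set Filter Topology
open scoped ComplexConjugate

variable {L : PeriodPair} {a b : ℝ}

theorem countable_lattice (L : PeriodPair) : (L.lattice : Set ℂ).Countable :=
  Set.countable_coe_iff.1 (Countable.of_equiv _ L.latticeEquivProd.symm.toEquiv)

theorem mem_lattice_rect (h1 : L.ω₁ = 2 * (a : ℂ)) (h2 : L.ω₂ = 2 * ((b : ℂ) * I)) {z : ℂ} :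
    z ∈ L.lattice ↔ ∃ m n : ℤ, z.re = m * (2 * a) ∧ z.im = n * (2 * b) := by
  rw [PeriodPair.mem_lattice]
  refine exists_congr fun m => exists_congr fun n => ?_
  rw [h1, h2, Complex.ext_iff]
  simp [eq_comm]

theorem halfLine_notMem_lattice (hb : 0 < b) (h1 : L.ω₁ = 2 * (a : ℂ))
    (h2 : L.ω₂ = 2 * ((b : ℂ) * I)) (x : ℝ) : (b : ℂ) * I + x ∉ L.lattice := by
  rw [mem_lattice_rect h1 h2]
  rintro ⟨m, n, -, h⟩
  have h' : b = n * (2 * b) := by simpa using h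
  have : (1 : ℝ) = n * 2 := by
    have := hb.ne'
    field_simp at h'
    linarith
  have : (1 : ℤ) = n * 2 := by exact_mod_cast this
  omega

/-- The Weierstrass function of a lattice that is stable under conjugation is real. -/
theorem weierstrassP_conj (h1 : L.ω₁ = 2 * (a : ℂ)) (h2 : L.ω₂ = 2 * ((b : ℂ) * I)) (z : ℂ) :
    L.weierstrassP (conj z) = conj (L.weierstrassP z) := by
  have hmem : ∀ l : L.lattice, conj (l : ℂ) ∈ L.lattice := by
    rintro ⟨l, hl⟩
    rw [mem_lattice_rect h1 h2] at hl ⊢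
    obtain ⟨m, n, hm, hn⟩ := hl
    exact ⟨m, -n, by simpa using hm, by simpa using hn⟩
  let e : L.lattice ≃ L.lattice := Function.Involutive.toPerm
    (fun l => ⟨conj (l : ℂ), hmem l⟩) (fun l => by simp)
  simp only [PeriodPair.weierstrassP]
  rw [conj_tsum, ← e.tsum_eq]
  refine tsum_congr fun l => ?_
  have he : ((e l : L.lattice) : ℂ) = conj (l : ℂ) := rfl
  simp [he]

theorem weierstrassP_halfLine_ofReal (h1 : L.ω₁ = 2 * (a : ℂ)) (h2 : L.ω₂ = 2 * ((b : ℂ) * I))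
    (x : ℝ) : ((L.weierstrassP (b * I + x)).re : ℂ) = L.weierstrassP (b * I + x) := by
  rw [← conj_eq_iff_re, ← weierstrassP_conj h1 h2]
  have := L.weierstrassP_add_coe (conj ((b : ℂ) * I + x)) ⟨L.ω₂, L.ω₂_mem_lattice⟩
  have e : conj ((b : ℂ) * I + x) + L.ω₂ = b * I + x := by
    rw [h2]; simp; ring
  rw [← this]
  exact congrArg _ e

theorem hasDerivAt_weierstrassP {z : ℂ} (hz : z ∉ L.lattice) :
    HasDerivAt L.weierstrassP (L.derivWeierstrassP z) z := by
  rw [← L.deriv_weierstrassP]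
  exact (L.analyticOnNhd_weierstrassP z hz).differentiableAt.hasDerivAt

/-- A translation along the half-period line that preserves `℘` on this line is by a lattice
vector: by the identity theorem it preserves `℘` everywhere, hence moves the pole at the origin
to a pole. -/
theorem mem_lattice_of_periodic_on_halfLine (hb : 0 < b) (h1 : L.ω₁ = 2 * (a : ℂ))
    (h2 : L.ω₂ = 2 * ((b : ℂ) * I)) {d : ℝ}
    (hd : ∀ x : ℝ, L.weierstrassP (b * I + x + d) = L.weierstrassP (b * I + x)) :
    (d : ℂ) ∈ L.lattice := by
  by_contra hdl
  set B : Set ℂ := L.lattice ∪ (fun z => z + (d : ℂ)) ⁻¹' L.lattice with hB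
  have hBc : B.Countable := (countable_lattice L).union
    ((countable_lattice L).preimage (add_left_injective _))
  have hconn : IsPreconnected Bᶜ :=
    (hBc.isConnected_compl_of_one_lt_rank (by simp)).isPreconnected
  have han1 : AnalyticOnNhd ℂ L.weierstrassP Bᶜ := fun z hz =>
    L.analyticOnNhd_weierstrassP z fun h => hz (Or.inl h)
  have hsh : ∀ z, z + (d : ℂ) ∉ L.lattice → AnalyticAt ℂ (fun z => L.weierstrassP (z + d)) z :=
    fun z hz =>
      AnalyticAt.fun_comp (f := fun z => z + (d : ℂ)) (L.analyticOnNhd_weierstrassP _ hz)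
        (by fun_prop)
  have hline : ∀ x : ℝ, (b : ℂ) * I + x ∈ Bᶜ := fun x h => by
    rcases h with h | h
    · exact halfLine_notMem_lattice hb h1 h2 x h
    · refine halfLine_notMem_lattice hb h1 h2 (x + d) ?_
      simpa [add_assoc] using h
  have hfreq : ∃ᶠ z in 𝓝[≠] ((b : ℂ) * I + (0 : ℝ)),
      L.weierstrassP (z + d) = L.weierstrassP z := by
    have ht : Tendsto (fun x : ℝ => (b : ℂ) * I + x) (𝓝[≠] 0) (𝓝[≠] ((b : ℂ) * I + (0 : ℝ))) := by
      refine tendsto_nhdsWithin_of_tendsto_nhds_of_eventually_within _ ?_ ?_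
      · have : Continuous fun x : ℝ => (b : ℂ) * I + x := by fun_prop
        exact (this.tendsto 0).mono_left nhdsWithin_le_nhds
      · filter_upwards [self_mem_nhdsWithin] with x hx
        simpa using hx
    exact ht.frequently (Frequently.of_forall fun x => hd x)
  have heq := AnalyticOnNhd.eqOn_of_preconnected_of_frequently_eq
    (f := fun z => L.weierstrassP (z + d)) (U := Bᶜ)
    (fun z hz => hsh z fun h => hz (Or.inr h)) han1 hconn (hline 0) hfreq
  have h0 : (0 : ℂ) ∈ L.lattice := zero_mem _
  have hev : (fun z => L.weierstrassP (z + d)) =ᶠ[𝓝[≠] 0] L.weierstrassP := by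
    have n1 : (↑L.lattice \ {0} : Set ℂ)ᶜ ∈ 𝓝 (0 : ℂ) := L.compl_lattice_sdiff_singleton_mem_nhds 0
    have n2 : ((fun z => z + (d : ℂ)) ⁻¹' L.lattice)ᶜ ∈ 𝓝 (0 : ℂ) := by
      refine (IsOpen.preimage (by fun_prop) L.isClosed_lattice.isOpen_compl).mem_nhds ?_
      simpa using hdl
    filter_upwards [nhdsWithin_le_nhds n1, nhdsWithin_le_nhds n2, self_mem_nhdsWithin]
      with z hz1 hz2 hz3
    refine heq fun h => ?_
    rcases h with h | h
    · exact hz1 ⟨h, hz3⟩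
    · exact hz2 h
  have hnn := (hsh 0 (by simpa using hdl)).meromorphicOrderAt_nonneg
  rw [meromorphicOrderAt_congr hev, L.order_weierstrassP 0 h0] at hnn
  exact absurd hnn (by decide)

/-- The second order equation `℘'' = 6 ℘² - g₂ / 2`. -/
theorem hasDerivAt_derivWeierstrassP (ha : 0 < a) (hb : 0 < b) (h1 : L.ω₁ = 2 * (a : ℂ))
    (h2 : L.ω₂ = 2 * ((b : ℂ) * I)) {z : ℂ} (hz : z ∉ L.lattice) :
    HasDerivAt L.derivWeierstrassP (6 * L.weierstrassP z ^ 2 - L.g₂ / 2) z := by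
  have hconn : IsPreconnected ((L.lattice : Set ℂ)ᶜ) :=
    ((countable_lattice L).isConnected_compl_of_one_lt_rank (by simp)).isPreconnected
  have hopen : IsOpen ((L.lattice : Set ℂ)ᶜ) := L.isClosed_lattice.isOpen_compl
  have hdd : ∀ z ∉ L.lattice, HasDerivAt L.derivWeierstrassP (deriv L.derivWeierstrassP z) z :=
    fun z hz => (L.analyticOnNhd_derivWeierstrassP z hz).differentiableAt.hasDerivAt
  have hprod : ∀ z ∈ ((L.lattice : Set ℂ)ᶜ), L.derivWeierstrassP z *
      (deriv L.derivWeierstrassP z - (6 * L.weierstrassP z ^ 2 - L.g₂ / 2)) = 0 := by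
    intro z hz
    have e1 := (hdd z hz).fun_pow 2
    have e2 := ((((hasDerivAt_weierstrassP hz).fun_pow 3).const_mul 4).sub
      ((hasDerivAt_weierstrassP hz).const_mul L.g₂)).sub_const L.g₃
    have e3 : (fun z => L.derivWeierstrassP z ^ 2) =ᶠ[𝓝 z]
        fun z => 4 * L.weierstrassP z ^ 3 - L.g₂ * L.weierstrassP z - L.g₃ :=
      eventually_of_mem (hopen.mem_nhds hz) fun z hz => L.derivWeierstrassP_sq z hz
    have e4 := e1.unique (e2.congr_of_eventuallyEq e3)
    norm_num at e4
    linear_combination e4 / 2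
  have hA2 : AnalyticOnNhd ℂ (fun z => deriv L.derivWeierstrassP z
      - (6 * L.weierstrassP z ^ 2 - L.g₂ / 2)) ((L.lattice : Set ℂ)ᶜ) := fun z hz => by
    have k1 := (L.analyticOnNhd_derivWeierstrassP z hz).deriv
    have k2 := L.analyticOnNhd_weierstrassP z hz
    fun_prop
  rcases AnalyticOnNhd.eq_zero_or_eq_zero_of_mul_eq_zero L.analyticOnNhd_derivWeierstrassP hA2
    hprod hconn with h | h
  · exfalso
    -- otherwise `℘` is constant on the half-period line, and every number is a period
    have hw : ∀ x : ℝ, HasDerivAt (fun x : ℝ => L.weierstrassP (b * I + x)) 0 x := fun x => by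
      have hx := halfLine_notMem_lattice hb h1 h2 x
      have k := (hasDerivAt_weierstrassP hx).comp_const_add ((b : ℂ) * I) (x : ℂ)
      rw [h _ hx] at k
      exact k.comp_ofReal
    have hc := is_const_of_deriv_eq_zero (fun x => (hw x).differentiableAt) (fun x => (hw x).deriv)
    have := mem_lattice_of_periodic_on_halfLine hb h1 h2 (d := a) (fun x => by
      have := hc (x + a) x
      simpa [add_assoc] using this)
    obtain ⟨m, n, hm, -⟩ := (mem_lattice_rect h1 h2).1 this
    have h3 : a = m * (2 * a) := by simpa using hm
    have : (1 : ℝ) = m * 2 := by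
      have := ha.ne'
      field_simp at h3
      linarith
    have : (1 : ℤ) = m * 2 := by exact_mod_cast this
    omega
  · have := h z hz
    rw [← sub_eq_zero.1 this]
    exact hdd z hz

end

/-! ### The cyclic system and its cubic equation -/

section

open Set Filter Topology
open scoped ComplexConjugate

/-- A solution `w`, with derivative `w'`, of the equation `w'² = 4 w³ - g₂ w - g₃` and of its
derivative, where `g₂ = 1/12 - 2c` and `g₃ = c/6 - 1/216 - c²`. -/
structure IsCubicSolution (c : ℝ) (w w' : ℝ → ℝ) : Prop where
  hasDerivAt : ∀ x, HasDerivAt w (w' x) x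
  hasDerivAt_deriv : ∀ x, HasDerivAt w' (6 * w x ^ 2 - (1 / 12 - 2 * c) / 2) x
  sq_eq : ∀ x, w' x ^ 2 = 4 * w x ^ 3 - (1 / 12 - 2 * c) * w x - (c / 6 - 1 / 216 - c ^ 2)

namespace IsCubicSolution

variable {c T : ℝ} {w w' W W' : ℝ → ℝ}

theorem comp_add (h : IsCubicSolution c w w') (d : ℝ) :
    IsCubicSolution c (fun s => w (d + s)) (fun s => w' (d + s)) where
  hasDerivAt x := (h.hasDerivAt (d + x)).comp_const_add d x
  hasDerivAt_deriv x := (h.hasDerivAt_deriv (d + x)).comp_const_add d x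
  sq_eq x := h.sq_eq (d + x)

theorem comp_sub (h : IsCubicSolution c w w') (d : ℝ) :
    IsCubicSolution c (fun s => w (d - s)) (fun s => -w' (d - s)) where
  hasDerivAt x := (h.hasDerivAt (d - x)).comp_const_sub d x
  hasDerivAt_deriv x := by
    simpa using ((h.hasDerivAt_deriv (d - x)).comp_const_sub d x).fun_neg
  sq_eq x := by simpa using h.sq_eq (d - x)

theorem eq_of_initial (h : IsCubicSolution c w w') (h' : IsCubicSolution c W W')
    (e : w 0 = W 0) (e' : w' 0 = W' 0) : w = W := by
  have hv : ContDiff ℝ 1 fun u : ℝ × ℝ => (u.2, 6 * u.1 ^ 2 - (1 / 12 - 2 * c) / 2) := by fun_prop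
  have := integralCurve_unique hv (γ := fun x => (w x, w' x)) (γ' := fun x => (W x, W' x))
    (fun t => (h.hasDerivAt t).prodMk (h.hasDerivAt_deriv t))
    (fun t => (h'.hasDerivAt t).prodMk (h'.hasDerivAt_deriv t)) (t₀ := 0) (by simp [e, e'])
  exact funext fun x => congrArg Prod.fst (congrFun this x)

theorem continuous (h : IsCubicSolution c w w') : Continuous w :=
  continuous_iff_continuousAt.2 fun x => (h.hasDerivAt x).continuousAt

theorem continuous_deriv (h : IsCubicSolution c w w') : Continuous w' :=
  continuous_iff_continuousAt.2 fun x => (h.hasDerivAt_deriv x).continuousAt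

/-- If the cubic `4 w³ - g₂ w - g₃` has the roots `m ≠ M`, its third root is `-m-M`. -/
theorem cubic_factor {m M x : ℝ} (hne : m ≠ M)
    (hm : 4 * m ^ 3 - (1 / 12 - 2 * c) * m - (c / 6 - 1 / 216 - c ^ 2) = 0)
    (hM : 4 * M ^ 3 - (1 / 12 - 2 * c) * M - (c / 6 - 1 / 216 - c ^ 2) = 0) :
    4 * x ^ 3 - (1 / 12 - 2 * c) * x - (c / 6 - 1 / 216 - c ^ 2)
      = 4 * (x - m) * (x - M) * (x + m + M) := by
  have h2 : 4 * (m ^ 2 + m * M + M ^ 2) = 1 / 12 - 2 * c := by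
    apply mul_left_cancel₀ (sub_ne_zero.2 hne)
    linear_combination hm - hM
  linear_combination (x - m) * h2 + hm

/-- A nonconstant periodic solution `W` oscillates between two roots of the cubic. Every solution
that starts below `1/12 - c`, where the cubic is negative, is therefore a translate of `W` up to
the sign of time, and of `W` itself if `W` is even. -/
theorem exists_shift (hW : IsCubicSolution c W W') (hT : 0 < T) (hper : Function.Periodic W T)
    (heven : ∀ x, W (-x) = W x) (hnc : ∃ x, W x ≠ W 0) (hc : 0 < c)
    (h : IsCubicSolution c w w') (h0 : w 0 < 1 / 12 - c) :
    ∃ x₀, ∀ s, w s = W (x₀ + s) := by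
  obtain ⟨xM, -, hM⟩ := isCompact_Icc.exists_isMaxOn (nonempty_Icc.2 hT.le)
    (hW.continuous.continuousOn (s := Icc 0 T))
  obtain ⟨xm, -, hm⟩ := isCompact_Icc.exists_isMinOn (nonempty_Icc.2 hT.le)
    (hW.continuous.continuousOn (s := Icc 0 T))
  have hM' : ∀ x, W x ≤ W xM := fun x => by
    obtain ⟨y, hy, e⟩ := hper.exists_mem_Ico₀ hT x
    rw [e]; exact hM (Ico_subset_Icc_self hy)
  have hm' : ∀ x, W xm ≤ W x := fun x => by
    obtain ⟨y, hy, e⟩ := hper.exists_mem_Ico₀ hT x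
    rw [e]; exact hm (Ico_subset_Icc_self hy)
  have dM : W' xM = 0 :=
    IsLocalMax.hasDerivAt_eq_zero (Eventually.of_forall hM') (hW.hasDerivAt xM)
  have dm : W' xm = 0 :=
    IsLocalMin.hasDerivAt_eq_zero (Eventually.of_forall hm') (hW.hasDerivAt xm)
  have hlt : W xm < W xM := by
    obtain ⟨x, hx⟩ := hnc
    rcases lt_or_gt_of_ne hx with hx | hx
    · linarith [hm' x, hM' 0]
    · linarith [hm' 0, hM' x]
  have rM := hW.sq_eq xM
  have rm := hW.sq_eq xm
  rw [dM, zero_pow two_ne_zero, eq_comm] at rM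
  rw [dm, zero_pow two_ne_zero, eq_comm] at rm
  have fac := fun x => cubic_factor (x := x) hlt.ne rm rM
  have hneg : 4 * ((1 / 12 - c) - W xm) * ((1 / 12 - c) - W xM) * ((1 / 12 - c) + W xm + W xM)
      < 0 := by
    rw [← fac]
    have : 0 < c ^ 3 := by positivity
    nlinarith
  have hnn : ∀ (u u' : ℝ → ℝ), IsCubicSolution c u u' → ∀ x,
      0 ≤ 4 * (u x - W xm) * (u x - W xM) * (u x + W xm + W xM) := fun u u' hu x => by
    rw [← fac, ← hu.sq_eq]; positivity
  -- the point `1/12 - c` lies outside of the range `[W xm, W xM]`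
  have hout : 1 / 12 - c < W xm ∨ W xM < 1 / 12 - c := by
    by_contra! hcon
    have hr := intermediate_value_univ xm xM hW.continuous ⟨hcon.1, hcon.2⟩
    obtain ⟨x, hx⟩ := hr
    have := hnn W W' hW x
    rw [hx] at this
    linarith
  have hthird : 1 / 12 - c < -(W xm + W xM) := by
    by_contra! hcon
    have h3 : 0 ≤ 1 / 12 - c + W xm + W xM := by linarith
    refine hneg.not_ge (mul_nonneg ?_ h3)
    rcases hout with ho | ho <;> nlinarith
  have hwn := hnn w w' h 0
  have hmul : (w 0 - W xm) * (w 0 - W xM) ≤ 0 := by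
    by_contra! hcon
    nlinarith
  have hmem : w 0 ∈ Icc (W xm) (W xM) := by
    constructor
    · by_contra! hcon
      nlinarith
    · by_contra! hcon
      nlinarith
  obtain ⟨x₁, hx₁⟩ := intermediate_value_univ xm xM hW.continuous hmem
  have hsq : W' x₁ ^ 2 = w' 0 ^ 2 := by rw [hW.sq_eq, h.sq_eq, hx₁]
  rcases sq_eq_sq_iff_eq_or_eq_neg.1 hsq with e | e
  · exact ⟨x₁, fun s => congrFun (h.eq_of_initial (hW.comp_add x₁) (by simp [hx₁])
      (by simp [e])) s⟩
  · refine ⟨-x₁, fun s => ?_⟩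
    rw [congrFun (h.eq_of_initial (hW.comp_sub x₁) (by simp [hx₁]) (by simp [e])) s, ← heven]
    congr 1; ring

/-- If all periods of an even solution are multiples of `T`, its derivative vanishes nowhere in
`(0, T/2)`: the solution is symmetric about every zero of its derivative. -/
theorem deriv_ne_zero (hW : IsCubicSolution c W W') (heven : ∀ x, W (-x) = W x)
    (hmin : ∀ d, (∀ x, W (x + d) = W x) → ∃ m : ℤ, d = m * T) {x : ℝ} (hx : x ∈ Ioo 0 (T / 2)) :
    W' x ≠ 0 := by
  intro h0
  have hsym := (hW.comp_add x).eq_of_initial (hW.comp_sub x) (by simp) (by simp [h0])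
  obtain ⟨m, hm⟩ := hmin (2 * x) fun s => by
    have := congrFun hsym (x + s)
    rw [show s + 2 * x = x + (x + s) by ring, this, ← heven]
    congr 1; ring
  have hT : 0 < T := by linarith [hx.1, hx.2]
  have h1 : (0 : ℝ) < m := by
    by_contra! hcon
    nlinarith [hx.1]
  have h2 : (m : ℝ) < 1 := by
    by_contra! hcon
    nlinarith [hx.2]
  have h1' : (0 : ℤ) < m := by exact_mod_cast h1
  have h2' : m < (1 : ℤ) := by exact_mod_cast h2
  omega

theorem deriv_mul_sub_pos (hW : IsCubicSolution c W W') (heven : ∀ x, W (-x) = W x) (hT : 0 < T)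
    (hmin : ∀ d, (∀ x, W (x + d) = W x) → ∃ m : ℤ, d = m * T) :
    0 < W' (T / 6) * (W (T / 2) - W (T / 6)) := by
  obtain ⟨ξ, hξ, e⟩ := exists_hasDerivAt_eq_slope W W' (a := T / 6) (b := T / 2) (by linarith)
    hW.continuous.continuousOn (fun x _ => hW.hasDerivAt x)
  have hne : ∀ x ∈ Ioo 0 (T / 2), W' x ≠ 0 := fun x hx => hW.deriv_ne_zero heven hmin hx
  have m1 : T / 6 ∈ Ioo 0 (T / 2) := ⟨by linarith, by linarith⟩
  have m2 : ξ ∈ Ioo 0 (T / 2) := ⟨by linarith [hξ.1], hξ.2⟩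
  have e' : W (T / 2) - W (T / 6) = W' ξ * (T / 3) := by
    rw [e]; field_simp; ring
  rw [e', ← mul_assoc]
  refine mul_pos ?_ (by linarith)
  -- the continuous function `W'` has no zero on the interval, hence a constant sign
  by_contra! hcon
  have hz : (0 : ℝ) ∈ W' '' Ioo 0 (T / 2) := by
    have hpc := (isPreconnected_Ioo (a := (0 : ℝ)) (b := T / 2)).image W'
      hW.continuous_deriv.continuousOn
    rcases le_total (W' (T / 6)) 0 with h | h
    · have h2 : 0 ≤ W' ξ := by
        by_contra! h2
        have h' := lt_of_le_of_ne h (hne _ m1)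
        nlinarith
      exact hpc.Icc_subset (mem_image_of_mem _ m1) (mem_image_of_mem _ m2) ⟨h, h2⟩
    · have h2 : W' ξ ≤ 0 := by
        by_contra! h2
        have h' := lt_of_le_of_ne h (hne _ m1).symm
        nlinarith
      exact hpc.Icc_subset (mem_image_of_mem _ m2) (mem_image_of_mem _ m1) ⟨h2, h⟩
  obtain ⟨x, hx, hx0⟩ := hz
  exact hne x hx hx0

end IsCubicSolution

/-- If `y₁, y₂, y₃` have sum `1` and product `c`, and `ẏ₁ = y₁ (y₂ - y₃)` cyclically, then
`1/12 - y₂ y₃` solves the cubic equation of the Weierstrass function. -/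
theorem isCubicSolution_of_cyclic {c : ℝ} {y₁ y₂ y₃ : ℝ → ℝ} (hs : ∀ s, y₁ s + y₂ s + y₃ s = 1)
    (hp : ∀ s, y₁ s * y₂ s * y₃ s = c)
    (h2 : ∀ s, HasDerivAt y₂ (y₂ s * (y₃ s - y₁ s)) s)
    (h3 : ∀ s, HasDerivAt y₃ (y₃ s * (y₁ s - y₂ s)) s) :
    IsCubicSolution c (fun s => 1 / 12 - y₂ s * y₃ s)
      (fun s => y₂ s * y₃ s * (y₂ s - y₃ s)) where
  hasDerivAt s := (((h2 s).fun_mul (h3 s)).const_sub (1 / 12)).congr_deriv (by ring)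
  hasDerivAt_deriv s := by
    refine (((h2 s).fun_mul (h3 s)).fun_mul ((h2 s).fun_sub (h3 s))).congr_deriv ?_
    have e1 : y₁ s = 1 - y₂ s - y₃ s := by linear_combination hs s
    rw [← hp s, e1]; ring
  sq_eq s := by
    have e1 : y₁ s = 1 - y₂ s - y₃ s := by linear_combination hs s
    rw [← hp s, e1]; ring

/-- The cyclic system and the Weierstrass function on its half-period line: the three functions
are translates of each other by a third of the period `T`. The cyclic symmetry gives a translation
by some `d` with `3 d ∈ T ℤ`; the direction of rotation excludes `d ≡ 0` and `d ≡ -T/3`. -/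
theorem exists_phase {c T : ℝ} {W W' y₁ y₂ y₃ : ℝ → ℝ} (hW : IsCubicSolution c W W')
    (hT : 0 < T) (hper : Function.Periodic W T) (heven : ∀ x, W (-x) = W x)
    (hmin : ∀ d, (∀ x, W (x + d) = W x) → ∃ m : ℤ, d = m * T)
    (hp1 : ∀ s, 0 < y₁ s) (hp2 : ∀ s, 0 < y₂ s) (hp3 : ∀ s, 0 < y₃ s)
    (hs : ∀ s, y₁ s + y₂ s + y₃ s = 1) (hp : ∀ s, y₁ s * y₂ s * y₃ s = c)
    (h1 : ∀ s, HasDerivAt y₁ (y₁ s * (y₂ s - y₃ s)) s)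
    (h2 : ∀ s, HasDerivAt y₂ (y₂ s * (y₃ s - y₁ s)) s)
    (h3 : ∀ s, HasDerivAt y₃ (y₃ s * (y₁ s - y₂ s)) s) :
    ∃ x₁, ∀ s, W (x₁ + s) = 1 / 12 - y₂ s * y₃ s ∧ W (x₁ + s + T / 3) = 1 / 12 - y₃ s * y₁ s ∧
      W (x₁ + s + 2 * (T / 3)) = 1 / 12 - y₁ s * y₂ s := by
  have hc : 0 < c := by rw [← hp 0]; exact mul_pos (mul_pos (hp1 0) (hp2 0)) (hp3 0)
  have hnc : ∃ x, W x ≠ W 0 := by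
    by_contra! hcon
    obtain ⟨m, hm⟩ := hmin (T / 2) fun x => by rw [hcon, hcon x]
    have : (1 : ℝ) = m * 2 := by
      have := hT.ne'
      field_simp at hm
      linarith
    have : (1 : ℤ) = m * 2 := by exact_mod_cast this
    omega
  have s1 := isCubicSolution_of_cyclic (y₁ := y₁) (c := c) hs hp h2 h3
  have s2 := isCubicSolution_of_cyclic (y₁ := y₂) (y₂ := y₃) (y₃ := y₁) (c := c)
    (fun s => by rw [← hs s]; ring) (fun s => by rw [← hp s]; ring) h3 h1
  have s3 := isCubicSolution_of_cyclic (y₁ := y₃) (y₂ := y₁) (y₃ := y₂) (c := c)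
    (fun s => by rw [← hs s]; ring) (fun s => by rw [← hp s]; ring) h1 h2
  have below : ∀ {u v w : ℝ}, 0 < u → 0 < v → 0 < w → u + v + w = 1 → u * v * w = c →
      1 / 12 - v * w < 1 / 12 - c := fun {u v w} hu hv hw e ec => by
    have : u < 1 := by linarith
    have : 0 < v * w := by positivity
    nlinarith
  obtain ⟨x₁, e1⟩ := hW.exists_shift hT hper heven hnc hc s1
    (below (hp1 0) (hp2 0) (hp3 0) (hs 0) (hp 0))
  obtain ⟨x₂, e2⟩ := hW.exists_shift hT hper heven hnc hc s2
    (below (hp2 0) (hp3 0) (hp1 0) (by rw [← hs 0]; ring) (by rw [← hp 0]; ring))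
  obtain ⟨x₃, e3⟩ := hW.exists_shift hT hper heven hnc hc s3
    (below (hp3 0) (hp1 0) (hp2 0) (by rw [← hs 0]; ring) (by rw [← hp 0]; ring))
  have d1 : ∀ s, y₂ s * y₃ s * (y₂ s - y₃ s) = W' (x₁ + s) := fun s =>
    (s1.hasDerivAt s).unique
      ((hW.comp_add x₁).hasDerivAt s |>.congr_of_eventuallyEq (Eventually.of_forall e1))
  have d2 : ∀ s, y₃ s * y₁ s * (y₃ s - y₁ s) = W' (x₂ + s) := fun s =>
    (s2.hasDerivAt s).unique
      ((hW.comp_add x₂).hasDerivAt s |>.congr_of_eventuallyEq (Eventually.of_forall e2))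
  have d3 : ∀ s, y₁ s * y₂ s * (y₁ s - y₂ s) = W' (x₃ + s) := fun s =>
    (s3.hasDerivAt s).unique
      ((hW.comp_add x₃).hasDerivAt s |>.congr_of_eventuallyEq (Eventually.of_forall e3))
  -- the value at one of the three arguments determines that at the next one
  let Ψ : ℝ → ℝ → ℝ := fun w u =>
    1 / 12 - c / ((1 - c / (1 / 12 - w) + u / (1 / 12 - w)) / 2)
  have hΨ : ∀ {u v w : ℝ}, 0 < u → 0 < v → 0 < w → u + v + w = 1 → u * v * w = c →
      Ψ (1 / 12 - v * w) (v * w * (v - w)) = 1 / 12 - w * u := fun {u v w} hu hv hw e ec => by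
    have hvw : v * w ≠ 0 := (mul_pos hv hw).ne'
    have q1 : c / (1 / 12 - (1 / 12 - v * w)) = u := by
      rw [sub_sub_cancel, ← ec]; field_simp
    have q2 : v * w * (v - w) / (1 / 12 - (1 / 12 - v * w)) = v - w := by
      rw [sub_sub_cancel]; field_simp
    have q3 : (1 - u + (v - w)) / 2 = v := by linarith
    simp only [Ψ, q1, q2, q3]
    rw [← ec]; field_simp
  set d := x₂ - x₁ with hd
  have step : ∀ x, W (x + d) = Ψ (W x) (W' x) := fun x => by
    have q := hΨ (hp1 (x - x₁)) (hp2 _) (hp3 _) (hs _) (hp _)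
    rw [e1, d1, e2] at q
    simp only [add_sub_cancel] at q
    rw [q]; congr 1; rw [hd]; ring
  have r2 : ∀ s, W (x₂ + s) = W (x₁ + s + d) := fun s => by congr 1; rw [hd]; ring
  have r3 : ∀ s, W (x₃ + s) = W (x₂ + s + d) := fun s => by
    have q := hΨ (hp2 s) (hp3 s) (hp1 s) (by rw [← hs s]; ring) (by rw [← hp s]; ring)
    rw [e2, d2, e3] at q
    rw [step, q]
  have r1 : ∀ s, W (x₁ + s) = W (x₃ + s + d) := fun s => by
    have q := hΨ (hp3 s) (hp1 s) (hp2 s) (by rw [← hs s]; ring) (by rw [← hp s]; ring)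
    rw [e3, d3, e1] at q
    rw [step, q]
  have r3' : ∀ s, W (x₃ + s) = W (x₁ + s + 2 * d) := fun s => by
    rw [r3, show x₂ + s + d = x₂ + (s + d) by ring, r2]; congr 1; ring
  obtain ⟨m, hm⟩ := hmin (3 * d) fun x => by
    have q := r1 (x - x₁)
    rw [show x₃ + (x - x₁) + d = x₃ + (x - x₁ + d) by ring, r3'] at q
    simp only [add_sub_cancel] at q
    rw [q]; congr 1; ring
  have hperZ : ∀ (k : ℤ) x, W (x + k * T) = W x := fun k x => by
    have := (hper.int_mul k) x
    simpa using this
  have hj : m % 3 = 0 ∨ m % 3 = 1 ∨ m % 3 = 2 := by omega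
  have hmk : (m : ℝ) = 3 * (m / 3 : ℤ) + (m % 3 : ℤ) := by
    exact_mod_cast (Int.mul_ediv_add_emod m 3).symm
  set k : ℤ := m / 3
  rcases hj with hj | hj | hj
  · exfalso
    have hdk : d = k * T := by
      rw [hj] at hmk; push_cast at hmk
      rw [hmk] at hm; linarith
    have q1 : ∀ s, y₁ s = y₂ s := fun s => by
      have := e2 s
      rw [r2, hdk, hperZ, ← e1] at this
      have h' := (hp3 s).ne'
      apply mul_left_cancel₀ h'; linarith
    have q2 : ∀ s, y₂ s = y₃ s := fun s => by
      have := e3 s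
      rw [r3, hdk, hperZ, ← e2] at this
      have h' := (hp1 s).ne'
      apply mul_left_cancel₀ h'; linarith
    refine hW.deriv_ne_zero heven hmin (x := T / 4) ⟨by linarith, by linarith⟩ ?_
    have := d1 (T / 4 - x₁)
    rw [q2, add_sub_cancel] at this
    rw [← this]; ring
  · have hdk : d = T / 3 + k * T := by
      rw [hj] at hmk; push_cast at hmk
      rw [hmk] at hm; linarith
    refine ⟨x₁, fun s => ⟨(e1 s).symm, ?_, ?_⟩⟩
    · rw [e2, r2, hdk, ← add_assoc, hperZ]
    · rw [e3, r3', hdk, show x₁ + s + 2 * (T / 3 + k * T) =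
        x₁ + s + 2 * (T / 3) + (2 * k : ℤ) * T by push_cast; ring, hperZ]
  · exfalso
    have hdk : d = 2 * (T / 3) + k * T := by
      rw [hj] at hmk; push_cast at hmk
      rw [hmk] at hm; linarith
    -- at the time `s` with `x₁ + s = T / 6` the solution would run backwards
    set s := T / 6 - x₁ with hs'
    have hxs : x₁ + s = T / 6 := by rw [hs']; ring
    have q1 := e1 s
    have q2 := e2 s
    have q3 := e3 s
    have q4 := d1 s
    have w2 : W (x₂ + s) = W (T / 6) := by
      rw [r2, hxs, hdk, ← heven, show -(T / 6 + (2 * (T / 3) + k * T))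
        = T / 6 + (-(k + 1) : ℤ) * T by push_cast; ring, hperZ]
    have w3 : W (x₃ + s) = W (T / 2) := by
      rw [r3', hxs, hdk, show T / 6 + 2 * (2 * (T / 3) + k * T)
        = T / 2 + (2 * k + 1 : ℤ) * T by push_cast; ring, hperZ]
    rw [w2] at q2
    rw [w3] at q3
    rw [hxs] at q1 q4
    have e12 : y₁ s = y₂ s := by
      have h' := (hp3 s).ne'
      apply mul_left_cancel₀ h'; linarith
    have := hW.deriv_mul_sub_pos heven hT hmin
    rw [← q4, ← q3, ← q1, e12] at this
    have h4 : 0 ≤ y₂ s ^ 2 * y₃ s * (y₂ s - y₃ s) ^ 2 := by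
      have := (hp3 s).le
      positivity
    nlinarith

end

/-! ### The moment map coordinates as elliptic functions -/

section

open Set Filter Topology
open scoped ComplexConjugate

variable {L : PeriodPair} {a b c : ℝ}

/-- On its half-period line, the Weierstrass function is a real solution of the cubic equation. -/
theorem isCubicSolution_weierstrassP (ha : 0 < a) (hb : 0 < b) (h1 : L.ω₁ = 2 * (a : ℂ))
    (h2 : L.ω₂ = 2 * ((b : ℂ) * I)) (hg2 : L.g₂ = 1 / 12 - 2 * (c : ℂ))
    (hg3 : L.g₃ = (c : ℂ) / 6 - 1 / 216 - (c : ℂ) ^ 2) :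
    IsCubicSolution c (fun x => (L.weierstrassP (b * I + x)).re)
      (fun x => (L.derivWeierstrassP (b * I + x)).re) := by
  have hx := halfLine_notMem_lattice hb h1 h2
  have hr := weierstrassP_halfLine_ofReal h1 h2
  have hd : ∀ x : ℝ, HasDerivAt (fun z : ℂ => L.weierstrassP (b * I + z))
      (L.derivWeierstrassP (b * I + x)) (x : ℂ) := fun x =>
    (hasDerivAt_weierstrassP (hx x)).comp_const_add _ _
  have hdd : ∀ x : ℝ, HasDerivAt (fun z : ℂ => L.derivWeierstrassP (b * I + z))
      (6 * L.weierstrassP (b * I + x) ^ 2 - L.g₂ / 2) (x : ℂ) := fun x =>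
    (hasDerivAt_derivWeierstrassP ha hb h1 h2 (hx x)).comp_const_add _ _
  have hr' : ∀ x : ℝ,
      ((L.derivWeierstrassP (b * I + x)).re : ℂ) = L.derivWeierstrassP (b * I + x) :=
    fun x => by
      have e1 := (hd x).real_of_complex.ofReal_comp
      have e2 := (hd x).comp_ofReal
      simp only [hr] at e1
      exact e1.unique e2
  refine ⟨fun x => (hd x).real_of_complex, fun x => ?_, fun x => ?_⟩
  · refine (hdd x).real_of_complex.congr_deriv ?_
    rw [← hr, hg2]
    have : (6 * ((L.weierstrassP (b * I + x)).re : ℂ) ^ 2 - (1 / 12 - 2 * (c : ℂ)) / 2)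
      = ((6 * (L.weierstrassP (b * I + x)).re ^ 2 - (1 / 12 - 2 * c) / 2 : ℝ) : ℂ) := by
      push_cast; ring
    rw [this, ofReal_re, ofReal_re]
  · have := L.derivWeierstrassP_sq _ (hx x)
    rw [← hr', ← hr, hg2, hg3] at this
    apply ofReal_injective
    push_cast
    exact this

/-- The solutions of the cyclic system are elliptic functions of time. -/
theorem exists_phase_weierstrassP (ha : 0 < a) (hb : 0 < b) (h1 : L.ω₁ = 2 * (a : ℂ))
    (h2 : L.ω₂ = 2 * ((b : ℂ) * I)) (hg2 : L.g₂ = 1 / 12 - 2 * (c : ℂ))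
    (hg3 : L.g₃ = (c : ℂ) / 6 - 1 / 216 - (c : ℂ) ^ 2) {u : ℝ → Fin 3 → ℝ}
    (hpos : ∀ s i, 0 < u s i) (hs : ∀ s, u s 0 + u s 1 + u s 2 = 1)
    (hp : ∀ s, u s 0 * u s 1 * u s 2 = c)
    (hu : ∀ s (i : Fin 3), HasDerivAt (fun s => u s i) (u s i * (u s (i + 1) - u s (i + 2))) s) :
    ∃ t₀ : ℝ, ∀ (s : ℝ) (i : Fin 3), (u s i : ℂ) = (c : ℂ) / (1 / 12 - L.weierstrassP
      ((b : ℂ) * I + (t₀ + s : ℝ) + ((i : ℕ) + 1 : ℂ) * (2 / 3 * (a : ℂ)))) := by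
  have hr := weierstrassP_halfLine_ofReal h1 h2
  have hper : ∀ z, L.weierstrassP (z + (2 * a : ℝ)) = L.weierstrassP z := fun z => by
    have := L.weierstrassP_add_coe z ⟨L.ω₁, L.ω₁_mem_lattice⟩
    rw [← this]; simp [h1]
  obtain ⟨x₁, hx₁⟩ := exists_phase (T := 2 * a)
    (isCubicSolution_weierstrassP ha hb h1 h2 hg2 hg3) (by linarith)
    (fun x => by
      have := hper (b * I + x)
      push_cast at this ⊢
      rw [← this, add_assoc])
    (fun x => by
      rw [← L.weierstrassP_neg, ← L.weierstrassP_add_coe _ ⟨L.ω₂, L.ω₂_mem_lattice⟩]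
      congr 2
      simp only [h2]; push_cast; ring)
    (fun d hd => by
      have : (d : ℂ) ∈ L.lattice := mem_lattice_of_periodic_on_halfLine hb h1 h2 fun x => by
        have := hd x
        rw [← ofReal_inj, hr, hr] at this
        rw [← this]; push_cast; congr 1; ring
      obtain ⟨m, n, hm, -⟩ := (mem_lattice_rect h1 h2).1 this
      exact ⟨m, by simpa using hm⟩)
    (fun s => hpos s 0) (fun s => hpos s 1) (fun s => hpos s 2) hs hp
    (fun s => hu s 0) (fun s => hu s 1) (fun s => hu s 2)
  -- an identity `℘ = 1/12 - v` with `u v = c` determines `u`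
  have key : ∀ (z : ℂ) (x u v w : ℝ), z = b * I + x →
      (L.weierstrassP (b * I + x)).re = 1 / 12 - v * w → u * v * w = c → 0 < v → 0 < w →
      (u : ℂ) = c / (1 / 12 - L.weierstrassP z) := fun z x u v w hz hw huv hv hw0 => by
    rw [hz, ← hr, hw, ← huv]
    have hv' : (v : ℂ) ≠ 0 := by exact_mod_cast hv.ne'
    have hw' : (w : ℂ) ≠ 0 := by exact_mod_cast hw0.ne'
    push_cast
    rw [sub_sub_cancel]
    field_simp
  refine ⟨x₁ - 2 * a / 3, fun s i => ?_⟩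
  obtain ⟨q1, q2, q3⟩ := hx₁ s
  fin_cases i
  · exact key _ _ _ _ _ (by simp; ring) q1 (hp s) (hpos s 1) (hpos s 2)
  · exact key _ _ _ _ _ (by simp; ring) q2 (by rw [← hp s]; simp; ring) (hpos s 2) (hpos s 0)
  · exact key _ _ _ _ _ (by simp; ring) q3 (by rw [← hp s]; simp; ring) (hpos s 0) (hpos s 1)

end

/-! ### The flow on the torus -/

section

open Set Filter Topology MeasureTheory

theorem isOpen_torus : IsOpen torus :=
  (isOpen_ne.preimage (continuous_apply 0)).inter (isOpen_ne.preimage (continuous_apply 1))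

theorem isOpen_torusX : IsOpen torusX :=
  (isOpen_ne.preimage (continuous_apply 0)).inter (isOpen_ne.preimage (continuous_apply 1))

/-- The logarithmic coordinates `r = (log |z₁|, log |z₂|)`. -/
def logAbs (z : Chart) : ℝ × ℝ := (Real.log ‖z 0‖, Real.log ‖z 1‖)

/-- The logarithmic differential `dz_k / z_k`. -/
def dlog (z : Chart) (k : Fin 2) : Chart →L[ℝ] ℂ := (z k)⁻¹ • ContinuousLinearMap.proj k

@[simp] theorem dlog_apply (z v : Chart) (k : Fin 2) : dlog z k v = v k / z k := by
  simp [dlog, div_eq_inv_mul]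

/-- The derivative of the logarithmic coordinates. -/
def dlogAbs (z : Chart) : Chart →L[ℝ] ℝ × ℝ :=
  (reCLM.comp (dlog z 0)).prod (reCLM.comp (dlog z 1))

@[simp] theorem dlogAbs_apply (z v : Chart) : dlogAbs z v = ((v 0 / z 0).re, (v 1 / z 1).re) := by
  simp [dlogAbs]

theorem hasFDerivAt_log_norm {E : Type*} [NormedAddCommGroup E] [NormedSpace ℝ E] {f : E → ℂ}
    {f' : E →L[ℝ] ℂ} {x : E} (hf : HasFDerivAt f f' x) (h0 : f x ≠ 0) :
    HasFDerivAt (fun x => Real.log ‖f x‖) (reCLM.comp ((f x)⁻¹ • f')) x := by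
  have e : ∀ x, Real.log ‖f x‖ = 1 / 2 * Real.log ((f x).re * (f x).re + (f x).im * (f x).im) :=
    fun x => by
      rw [← normSq_apply, normSq_eq_norm_sq, Real.log_pow]; push_cast; ring
  have h1 := reCLM.hasFDerivAt.comp x hf
  have h2 := imCLM.hasFDerivAt.comp x hf
  have hne : (f x).re * (f x).re + (f x).im * (f x).im ≠ 0 := by
    rw [← normSq_apply]; exact fun h => h0 (normSq_eq_zero.1 h)
  refine ((((h1.mul h1).add (h2.mul h2)).log hne).const_mul (1 / 2)).congr_fderiv ?_
    |>.congr_of_eventuallyEq (Eventually.of_forall e)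
  ext v
  have hn : normSq (f x) ≠ 0 := fun h => h0 (normSq_eq_zero.1 h)
  simp [inv_re, inv_im, ← normSq_apply]
  field_simp
  ring

theorem hasFDerivAt_logAbs {z : Chart} (hz : z ∈ torus) :
    HasFDerivAt logAbs (dlogAbs z) z := by
  have hp : ∀ k, HasFDerivAt (fun z : Chart => z k) (ContinuousLinearMap.proj (R := ℝ) k) z :=
    fun k => hasFDerivAt_apply k z
  exact (hasFDerivAt_log_norm (hp 0) hz.1).prodMk (hasFDerivAt_log_norm (hp 1) hz.2)

theorem exp_two_mul_log_norm {w : ℂ} (hw : w ≠ 0) : Real.exp (2 * Real.log ‖w‖) = ‖w‖ ^ 2 := by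
  rw [two_mul, Real.exp_add, Real.exp_log (norm_pos_iff.2 hw), sq]

theorem y_eq {z : Chart} (hz : z ∈ torus) :
    y z = ![m₁ (logAbs z), m₂ (logAbs z), 1 - m₁ (logAbs z) - m₂ (logAbs z)] := by
  rw [one_sub_m₁_sub_m₂]
  simp [y, m₁, m₂, logAbs, exp_two_mul_log_norm hz.1, exp_two_mul_log_norm hz.2]

theorem log_m₁ (r : ℝ × ℝ) :
    Real.log (m₁ r) = 2 * r.1 - Real.log (1 + Real.exp (2 * r.1) + Real.exp (2 * r.2)) := by
  rw [m₁, Real.log_div (by positivity) (by positivity), Real.log_exp]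

theorem log_m₂ (r : ℝ × ℝ) :
    Real.log (m₂ r) = 2 * r.2 - Real.log (1 + Real.exp (2 * r.1) + Real.exp (2 * r.2)) := by
  rw [m₂, Real.log_div (by positivity) (by positivity), Real.log_exp]

theorem log_one_sub_m₁_sub_m₂ (r : ℝ × ℝ) :
    Real.log (1 - m₁ r - m₂ r) = -Real.log (1 + Real.exp (2 * r.1) + Real.exp (2 * r.2)) := by
  rw [one_sub_m₁_sub_m₂, one_div, Real.log_inv]

theorem m₃_pos (r : ℝ × ℝ) : 0 < 1 - m₁ r - m₂ r := by linarith [m₁_add_m₂_lt_one r]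

theorem log_c₃_eq {z : Chart} (hz : z ∈ torus) : Real.log (c₃ z) = -4 * ham (logAbs z) := by
  have h1 := m₁_pos (logAbs z); have h2 := m₂_pos (logAbs z); have h3 := m₃_pos (logAbs z)
  rw [c₃, y_eq hz]
  simp only [Matrix.cons_val]
  rw [Real.log_mul (by positivity) h3.ne', Real.log_mul h1.ne' h2.ne', log_m₁, log_m₂,
    log_one_sub_m₁_sub_m₂, ham]
  ring

theorem h_eq {z : Chart} (hz : z ∈ torus) : h z = ham (logAbs z) := by
  rw [h, log_c₃_eq hz]; ring

theorem hasFDerivAt_h {z : Chart} (hz : z ∈ torus) : HasFDerivAt h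
    ((-(field (logAbs z)).2 • ContinuousLinearMap.fst ℝ ℝ ℝ
      + (field (logAbs z)).1 • ContinuousLinearMap.snd ℝ ℝ ℝ).comp (dlogAbs z)) z :=
  ((hasFDerivAt_ham (logAbs z)).comp z (hasFDerivAt_logAbs hz)).congr_of_eventuallyEq
    (eventually_of_mem (isOpen_torus.mem_nhds hz) fun _ hw => h_eq hw)

/-- The covector `v ↦ Re ∑ a_k v_k` has the `(1,0)`-components `a_k / 2`. -/
theorem comp10_of_re {n : ℕ} {α : (Fin n → ℂ) →L[ℝ] ℝ} {a : Fin n → ℂ}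
    (h : ∀ v, α v = (∑ k, a k * v k).re) (k : Fin n) : comp10 α k = a k / 2 := by
  have h1 : α (Pi.single k 1) = (a k).re := by rw [h]; simp [Pi.single_apply]
  have h2 : α (Pi.single k I) = -(a k).im := by rw [h]; simp [Pi.single_apply]
  rw [comp10, h1, h2]
  conv_rhs => rw [← re_add_im (a k)]
  push_cast; ring

theorem sharp_of_re {n : ℕ} (π : Matrix (Fin n) (Fin n) ℂ) {α : (Fin n → ℂ) →L[ℝ] ℝ}
    {a : Fin n → ℂ} (h : ∀ v, α v = (∑ k, a k * v k).re) (j : Fin n) :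
    sharp π α j = -I * ∑ k, π j k * a k := by
  simp only [sharp, comp10_of_re h, Finset.mul_sum]
  exact Finset.sum_congr rfl fun k _ => by ring

theorem V_eq {z : Chart} (hz : z ∈ torus) :
    V z = ![(field (logAbs z)).1 * z 0, (field (logAbs z)).2 * z 1] := by
  have hα : ∀ v, fderiv ℝ h z v = (∑ k, ![-((field (logAbs z)).2 : ℂ) / z 0,
      ((field (logAbs z)).1 : ℂ) / z 1] k * v k).re := fun v => by
    rw [(hasFDerivAt_h hz).fderiv]
    simp only [Fin.sum_univ_two, Matrix.cons_val, add_re, div_mul_eq_mul_div, mul_div_assoc]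
    rw [← ofReal_neg, re_ofReal_mul, re_ofReal_mul]
    simp
  have h0 := hz.1; have h1 := hz.2
  ext j
  rw [V, sharp_of_re _ hα]
  fin_cases j
  · simp [sigma]; field_simp; simp
  · simp [sigma]; field_simp; simp

/-- The flow of `V`: in logarithmic coordinates it moves the absolute values by the planar flow
and keeps the arguments. -/
def chartFlow (t : ℝ) (z : Chart) : Chart :=
  ![z 0 * exp (disp t (logAbs z)).1, z 1 * exp (disp t (logAbs z)).2]

theorem chartFlow_mem {z : Chart} (hz : z ∈ torus) (t : ℝ) : chartFlow t z ∈ torus :=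
  ⟨mul_ne_zero hz.1 (exp_ne_zero _), mul_ne_zero hz.2 (exp_ne_zero _)⟩

theorem logAbs_chartFlow {z : Chart} (hz : z ∈ torus) (t : ℝ) :
    logAbs (chartFlow t z) = flow t (logAbs z) := by
  have h0 : ‖z 0‖ ≠ 0 := norm_ne_zero_iff.2 hz.1
  have h1 : ‖z 1‖ ≠ 0 := norm_ne_zero_iff.2 hz.2
  have e : flow t (logAbs z) = logAbs z + disp t (logAbs z) := by simp [disp]
  rw [e]
  ext <;> simp [logAbs, chartFlow, norm_exp] <;> rw [Real.log_mul (by assumption) (by positivity),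
    Real.log_exp]

theorem chartFlow_zero (z : Chart) : chartFlow 0 z = z := by
  ext k; fin_cases k <;> simp [chartFlow, disp_zero]

theorem hasDerivAt_vec2 {f g : ℝ → ℂ} {f' g' : ℂ} {t : ℝ} (hf : HasDerivAt f f' t)
    (hg : HasDerivAt g g' t) : HasDerivAt (fun s => (![f s, g s] : Fin 2 → ℂ)) ![f', g'] t := by
  refine hasDerivAt_pi.2 fun k => ?_
  fin_cases k
  · exact hf
  · exact hg

theorem isFlowOn_chartFlow : IsFlowOn torus V chartFlow := by
  refine fun z hz => ⟨chartFlow_zero z, fun t => ⟨chartFlow_mem hz t, ?_⟩⟩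
  rw [V_eq (chartFlow_mem hz t), logAbs_chartFlow hz]
  have h1 := (hasDerivAt_fst_comp (hasDerivAt_disp (logAbs z) t)).ofReal_comp
  have h2 := (hasDerivAt_snd_comp (hasDerivAt_disp (logAbs z) t)).ofReal_comp
  refine (hasDerivAt_vec2 (h1.cexp.const_mul (z 0)) (h2.cexp.const_mul (z 1))).congr_deriv ?_
  ext k; fin_cases k <;> simp [chartFlow] <;> ring

theorem IsFlowOn.eq_chartFlow {φ : ℝ → Chart → Chart} (hφ : IsFlowOn torus V φ) {z : Chart}
    (hz : z ∈ torus) (t : ℝ) : φ t z = chartFlow t z := by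
  obtain ⟨h0, hd⟩ := hφ z hz
  have hcoord : ∀ t k, HasDerivAt (fun s => φ s z k) (V (φ t z) k) t := fun t k =>
    hasDerivAt_pi.1 (hd t).2 k
  have hlog : (fun s => logAbs (φ s z)) = fun s => flow s (logAbs z) := by
    refine integralCurve_unique (contDiff_field.of_le (by norm_num)) (fun t => ?_)
      (fun t => hasDerivAt_flow _ t) (t₀ := 0) (by rw [h0, flow_zero])
    refine ((hasFDerivAt_logAbs (hd t).1).comp_hasDerivAt t (hd t).2).congr_deriv ?_
    have k0 := (hd t).1.1; have k1 := (hd t).1.2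
    rw [V_eq (hd t).1]
    simp [k0, k1]
  have hr : ∀ t, logAbs (φ t z) = flow t (logAbs z) := congrFun hlog
  -- each coordinate divided by its expected growth factor is constant
  have key : ∀ (k : Fin 2) (R R' : ℝ → ℝ), (∀ t, HasDerivAt R (R' t) t) → R 0 = 0 →
      (∀ t, V (φ t z) k = R' t * φ t z k) → φ t z k = z k * exp (R t) := by
    intro k R R' hR hR0 hV
    have hc : ∀ t, HasDerivAt (fun s => φ s z k * exp (-(R s : ℂ))) 0 t := fun t => by
      refine ((hcoord t k).fun_mul (hR t).ofReal_comp.fun_neg.cexp).congr_deriv ?_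
      rw [hV]; ring
    have := is_const_of_deriv_eq_zero (fun s => (hc s).differentiableAt) (fun s => (hc s).deriv) t 0
    simp only [hR0, h0, ofReal_zero, neg_zero, Complex.exp_zero, mul_one] at this
    rw [← this, mul_assoc, ← Complex.exp_add, neg_add_cancel, Complex.exp_zero, mul_one]
  ext k
  fin_cases k
  · exact key 0 _ _ (fun t => hasDerivAt_fst_comp (hasDerivAt_disp (logAbs z) t))
      (by simp [disp_zero]) fun t => by rw [V_eq (hd t).1, hr]; simp
  · exact key 1 _ _ (fun t => hasDerivAt_snd_comp (hasDerivAt_disp (logAbs z) t))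
      (by simp [disp_zero]) fun t => by rw [V_eq (hd t).1, hr]; simp

end

/-! ### The flow on the groupoid -/

section

open Set Filter Topology MeasureTheory

theorem target_mem {x : X} (hx : x ∈ torusX) : target x ∈ torus :=
  ⟨mul_ne_zero hx.1 (exp_ne_zero _), mul_ne_zero hx.2 (exp_ne_zero _)⟩

theorem hasFDerivAt_coord (x : X) (k : Fin 4) :
    HasFDerivAt (fun x : X => x k) (ContinuousLinearMap.proj (R := ℝ) (φ := fun _ => ℂ) k) x :=
  hasFDerivAt_apply k x

/-- The derivative of the target map. -/
def targetDeriv (x : X) : X →L[ℝ] Chart :=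
  ContinuousLinearMap.pi
    ![exp (x 3 * x 1) • (ContinuousLinearMap.proj 0 + (x 0 * x 1) • ContinuousLinearMap.proj 3
        + (x 0 * x 3) • ContinuousLinearMap.proj 1),
      exp (-(x 2 * x 0)) • (ContinuousLinearMap.proj 1 - (x 1 * x 0) • ContinuousLinearMap.proj 2
        - (x 1 * x 2) • ContinuousLinearMap.proj 0)]

theorem hasFDerivAt_vec2 {E : Type*} [NormedAddCommGroup E] [NormedSpace ℝ E] {f g : E → ℂ}
    {f' g' : E →L[ℝ] ℂ} {x : E} (hf : HasFDerivAt f f' x) (hg : HasFDerivAt g g' x) :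
    HasFDerivAt (fun s => (![f s, g s] : Fin 2 → ℂ)) (ContinuousLinearMap.pi ![f', g']) x := by
  refine hasFDerivAt_pi.2 fun k => ?_
  fin_cases k
  · exact hf
  · exact hg

theorem hasFDerivAt_target (x : X) : HasFDerivAt target (targetDeriv x) x := by
  have c := hasFDerivAt_coord x
  refine (hasFDerivAt_vec2 ((c 0).mul ((c 3).mul (c 1)).cexp)
    ((c 1).mul ((c 2).mul (c 0)).neg.cexp)).congr_fderiv ?_
  ext v k
  fin_cases k <;> simp [targetDeriv] <;> ring

/-- The derivative of the coordinates `q`. -/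
def qDeriv (x : X) : X →L[ℝ] Fin 2 → ℂ :=
  ContinuousLinearMap.pi
    ![exp (x 3 * x 1 / 2) • (ContinuousLinearMap.proj 0
        + (x 0 * x 1 / 2) • ContinuousLinearMap.proj 3
        + (x 0 * x 3 / 2) • ContinuousLinearMap.proj 1),
      exp (-(x 2 * x 0 / 2)) • (ContinuousLinearMap.proj 1
        - (x 1 * x 0 / 2) • ContinuousLinearMap.proj 2
        - (x 1 * x 2 / 2) • ContinuousLinearMap.proj 0)]

theorem hasFDerivAt_q (x : X) : HasFDerivAt q (qDeriv x) x := by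
  have c := hasFDerivAt_coord x
  refine (hasFDerivAt_vec2 ((c 0).mul (((c 3).mul (c 1)).mul_const (2⁻¹ : ℂ)).cexp)
    ((c 1).mul (((c 2).mul (c 0)).mul_const (2⁻¹ : ℂ)).neg.cexp)).congr_fderiv ?_
    |>.congr_of_eventuallyEq (Eventually.of_forall fun x => ?_)
  · ext v k
    fin_cases k <;> simp [qDeriv, div_eq_mul_inv] <;> ring
  · simp [q, div_eq_mul_inv]

/-- The derivative of the coordinates `p`. -/
def pDeriv (x : X) : X →L[ℝ] Fin 2 → ℂ :=
  ContinuousLinearMap.pi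
    ![exp (-(x 3 * x 1 / 2)) • (ContinuousLinearMap.proj 2
        - (x 2 * x 1 / 2) • ContinuousLinearMap.proj 3
        - (x 2 * x 3 / 2) • ContinuousLinearMap.proj 1),
      exp (x 2 * x 0 / 2) • (ContinuousLinearMap.proj 3
        + (x 3 * x 0 / 2) • ContinuousLinearMap.proj 2
        + (x 3 * x 2 / 2) • ContinuousLinearMap.proj 0)]

theorem hasFDerivAt_p (x : X) : HasFDerivAt p (pDeriv x) x := by
  have c := hasFDerivAt_coord x
  refine (hasFDerivAt_vec2 ((c 2).mul (((c 3).mul (c 1)).mul_const (2⁻¹ : ℂ)).neg.cexp)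
    ((c 3).mul (((c 2).mul (c 0)).mul_const (2⁻¹ : ℂ)).cexp)).congr_fderiv ?_
    |>.congr_of_eventuallyEq (Eventually.of_forall fun x => ?_)
  · ext v k
    fin_cases k <;> simp [pDeriv, div_eq_mul_inv] <;> ring
  · simp [p, div_eq_mul_inv]

/-- `(p, q)` are Darboux coordinates for `Ω₀`. -/
theorem Omega_eq_dp_wedge_dq (x u v : X) : Omega x u v =
    I * ∑ k, (pDeriv x u k * qDeriv x v k - pDeriv x v k * qDeriv x u k) := by
  have e0 : exp (-(x 3 * x 1 / 2)) * exp (x 3 * x 1 / 2) = 1 := by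
    rw [← Complex.exp_add, neg_add_cancel, Complex.exp_zero]
  have e1 : exp (x 2 * x 0 / 2) * exp (-(x 2 * x 0 / 2)) = 1 := by
    rw [← Complex.exp_add, add_neg_cancel, Complex.exp_zero]
  simp only [Omega, OmegaMatrix, pDeriv, qDeriv, Fin.sum_univ_two, dotProduct, Matrix.mulVec,
    Fin.sum_univ_four, ContinuousLinearMap.coe_pi', Matrix.cons_val, smul_apply, add_apply,
    sub_apply, ContinuousLinearMap.proj_apply, smul_eq_mul, Matrix.smul_apply, Matrix.of_apply]
  generalize exp (-(x 3 * x 1 / 2)) = a at *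
  generalize exp (x 3 * x 1 / 2) = a' at *
  generalize exp (x 2 * x 0 / 2) = b at *
  generalize exp (-(x 2 * x 0 / 2)) = b' at *
  linear_combination
    (-I * ((u 2 - x 2 * x 1 / 2 * u 3 - x 2 * x 3 / 2 * u 1) *
        (v 0 + x 0 * x 1 / 2 * v 3 + x 0 * x 3 / 2 * v 1)
      - (v 2 - x 2 * x 1 / 2 * v 3 - x 2 * x 3 / 2 * v 1) *
        (u 0 + x 0 * x 1 / 2 * u 3 + x 0 * x 3 / 2 * u 1))) * e0
    + (-I * ((u 3 + x 3 * x 0 / 2 * u 2 + x 3 * x 2 / 2 * u 0) *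
        (v 1 - x 1 * x 0 / 2 * v 2 - x 1 * x 2 / 2 * v 0)
      - (v 3 + x 3 * x 0 / 2 * v 2 + x 3 * x 2 / 2 * v 0) *
        (u 1 - x 1 * x 0 / 2 * u 2 - x 1 * x 2 / 2 * u 0))) * e1

theorem eq_zero_of_pDeriv_qDeriv {x u : X} (hp : pDeriv x u = 0) (hq : qDeriv x u = 0) :
    u = 0 := by
  have hp0 := congrFun hp 0; have hp1 := congrFun hp 1
  have hq0 := congrFun hq 0; have hq1 := congrFun hq 1
  simp only [pDeriv, qDeriv, ContinuousLinearMap.coe_pi', Matrix.cons_val, smul_apply, add_apply,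
    sub_apply, ContinuousLinearMap.proj_apply, smul_eq_mul, Pi.zero_apply, mul_eq_zero,
    Complex.exp_ne_zero, false_or] at hp0 hp1 hq0 hq1
  have hr : x 2 * u 0 + x 0 * u 2 = 0 := by linear_combination x 2 * hq0 + x 0 * hp0
  have h1 : u 1 = 0 := by linear_combination hq1 + x 1 / 2 * hr
  have h3 : u 3 = 0 := by linear_combination hp1 - x 3 / 2 * hr
  rw [h1, h3] at hp0 hq0
  ext k
  fin_cases k
  · simpa using hq0
  · exact h1
  · simpa using hp0
  · exact h3

/-- The holomorphic 2-form `d log z₁ ∧ d log z₂` on the torus. -/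
def logForm (z u v : Chart) : ℂ := (u 0 * v 1 - u 1 * v 0) / (z 0 * z 1)

/-- On the groupoid over the torus, `Ω₀ = t^*B - s^*B` for `B = i d log z₁ ∧ d log z₂`, the inverse
of `σ` up to sign. -/
theorem Omega_eq_target_sub_source {x : X} (hx : x ∈ torusX) (u v : X) :
    Omega x u v = I * (logForm (target x) (targetDeriv x u) (targetDeriv x v)
      - logForm ![x 0, x 1] ![u 0, u 1] ![v 0, v 1]) := by
  have h0 : x 0 ≠ 0 := hx.1
  have h1 : x 1 ≠ 0 := hx.2
  have e0 := exp_ne_zero (x 3 * x 1)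
  have e1 := exp_ne_zero (-(x 2 * x 0))
  simp only [Omega, OmegaMatrix, targetDeriv, target, logForm, dotProduct, Matrix.mulVec,
    Fin.sum_univ_four, ContinuousLinearMap.coe_pi', Matrix.cons_val, smul_apply, add_apply,
    sub_apply, ContinuousLinearMap.proj_apply, smul_eq_mul, Matrix.smul_apply, Matrix.of_apply]
  generalize exp (x 3 * x 1) = a at *
  generalize exp (-(x 2 * x 0)) = b at *
  field_simp
  ring

theorem Vhat_eq {x : X} (hx : x ∈ torusX) :
    Vhat x = ![0, 0, -((field (logAbs (target x))).2 : ℂ) / x 0,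
      ((field (logAbs (target x))).1 : ℂ) / x 1] := by
  have hα : ∀ v, fderiv ℝ (fun x' => h (target x')) x v = (∑ k,
      ![-((field (logAbs (target x))).2 : ℂ) / x 0 - ((field (logAbs (target x))).1 : ℂ) * x 2,
        -((field (logAbs (target x))).2 : ℂ) * x 3 + ((field (logAbs (target x))).1 : ℂ) / x 1,
        -((field (logAbs (target x))).1 : ℂ) * x 0,
        -((field (logAbs (target x))).2 : ℂ) * x 1] k * v k).re := fun v => by
    rw [show (fun x' => h (target x')) = h ∘ target from rfl,
      ((hasFDerivAt_h (target_mem hx)).comp x (hasFDerivAt_target x)).fderiv]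
    have h0 : x 0 ≠ 0 := hx.1
    have h1 : x 1 ≠ 0 := hx.2
    have e0 := exp_ne_zero (x 3 * x 1)
    have e1 := exp_ne_zero (-(x 2 * x 0))
    simp only [ContinuousLinearMap.comp_apply, add_apply, smul_apply, smul_eq_mul, dlogAbs_apply,
      ContinuousLinearMap.coe_fst', ContinuousLinearMap.coe_snd', ← re_ofReal_mul, ← add_re]
    generalize (field (logAbs (target x))).1 = c
    generalize (field (logAbs (target x))).2 = c'
    congr 1
    simp only [targetDeriv, target, Fin.sum_univ_four, ContinuousLinearMap.coe_pi',
      Matrix.cons_val, smul_apply, add_apply, sub_apply, ContinuousLinearMap.proj_apply,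
      smul_eq_mul]
    generalize exp (x 3 * x 1) = a at *
    generalize exp (-(x 2 * x 0)) = b at *
    push_cast
    field_simp
    ring
  have h0 : x 0 ≠ 0 := hx.1
  have h1 : x 1 ≠ 0 := hx.2
  ext j
  rw [Vhat, sharp_of_re _ hα, OmegaMatrix_inv]
  generalize ((field (logAbs (target x))).1 : ℂ) = c
  generalize ((field (logAbs (target x))).2 : ℂ) = c'
  simp only [Fin.sum_univ_four, Matrix.smul_apply, Matrix.of_apply, Matrix.cons_val, smul_eq_mul]
  fin_cases j <;> simp <;> field_simp <;> simp <;> ring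

/-- The flow of `V̂`: it fixes the source and moves the target by the flow of `V`. -/
def groupoidFlow (t : ℝ) (x : X) : X :=
  ![x 0, x 1, x 2 - (disp t (logAbs (target x))).2 / x 0,
    x 3 + (disp t (logAbs (target x))).1 / x 1]

theorem groupoidFlow_mem {x : X} (hx : x ∈ torusX) (t : ℝ) : groupoidFlow t x ∈ torusX := hx

theorem target_groupoidFlow {x : X} (hx : x ∈ torusX) (t : ℝ) :
    target (groupoidFlow t x) = chartFlow t (target x) := by
  have h0 : x 0 ≠ 0 := hx.1
  have h1 : x 1 ≠ 0 := hx.2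
  ext k
  fin_cases k
  · change x 0 * exp ((x 3 + (disp t (logAbs (target x))).1 / x 1) * x 1)
      = x 0 * exp (x 3 * x 1) * exp (disp t (logAbs (target x))).1
    rw [mul_assoc, ← Complex.exp_add]
    congr 2; field_simp
  · change x 1 * exp (-((x 2 - (disp t (logAbs (target x))).2 / x 0) * x 0))
      = x 1 * exp (-(x 2 * x 0)) * exp (disp t (logAbs (target x))).2
    rw [mul_assoc, ← Complex.exp_add]
    congr 2; field_simp; ring

theorem isFlowOn_groupoidFlow : IsFlowOn torusX Vhat groupoidFlow := by
  refine fun x hx => ⟨?_, fun t => ⟨hx, ?_⟩⟩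
  · ext k; fin_cases k <;> simp [groupoidFlow, disp_zero]
  rw [Vhat_eq (groupoidFlow_mem hx t), target_groupoidFlow hx, logAbs_chartFlow (target_mem hx)]
  have h1 := (hasDerivAt_fst_comp (hasDerivAt_disp (logAbs (target x)) t)).ofReal_comp
  have h2 := (hasDerivAt_snd_comp (hasDerivAt_disp (logAbs (target x)) t)).ofReal_comp
  refine hasDerivAt_pi.2 fun k => ?_
  fin_cases k
  · exact hasDerivAt_const t (x 0)
  · exact hasDerivAt_const t (x 1)
  · exact ((h2.div_const (x 0)).const_sub (x 2)).congr_deriv (by simp [groupoidFlow, neg_div])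
  · exact (h1.div_const (x 1)).const_add (x 3)

theorem IsFlowOn.eq_groupoidFlow {Φ : ℝ → X → X} (hΦ : IsFlowOn torusX Vhat Φ) {x : X}
    (hx : x ∈ torusX) (t : ℝ) : Φ t x = groupoidFlow t x := by
  obtain ⟨h0, hd⟩ := hΦ x hx
  have hcoord : ∀ t k, HasDerivAt (fun s => Φ s x k) (Vhat (Φ t x) k) t := fun t k =>
    hasDerivAt_pi.1 (hd t).2 k
  have hconst : ∀ (k : Fin 4) (f : ℝ → ℂ), (∀ t, HasDerivAt f (Vhat (Φ t x) k) t) →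
      ∀ t, Φ t x k = x k + (f t - f 0) := fun k f hf t => by
    have hc : ∀ t, HasDerivAt (fun s => Φ s x k - f s) 0 t := fun t =>
      ((hcoord t k).fun_sub (hf t)).congr_deriv (sub_self _)
    have := is_const_of_deriv_eq_zero (fun s => (hc s).differentiableAt) (fun s => (hc s).deriv) t 0
    simp only [h0] at this
    linear_combination this
  have e0 : ∀ t, Φ t x 0 = x 0 := fun t => by
    have := hconst 0 (fun _ => 0) (fun t => by
      rw [Vhat_eq (hd t).1]; exact hasDerivAt_const t 0) t
    simpa using this
  have e1 : ∀ t, Φ t x 1 = x 1 := fun t => by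
    have := hconst 1 (fun _ => 0) (fun t => by
      rw [Vhat_eq (hd t).1]; exact hasDerivAt_const t 0) t
    simpa using this
  have hlog : (fun s => logAbs (target (Φ s x))) = fun s => flow s (logAbs (target x)) := by
    refine integralCurve_unique (contDiff_field.of_le (by norm_num)) (fun t => ?_)
      (fun t => hasDerivAt_flow _ t) (t₀ := 0) (by rw [h0, flow_zero])
    refine ((hasFDerivAt_logAbs (target_mem (hd t).1)).comp_hasDerivAt t
      ((hasFDerivAt_target (Φ t x)).comp_hasDerivAt t (hd t).2)).congr_deriv ?_
    have k0 : Φ t x 0 ≠ 0 := (hd t).1.1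
    have k1 : Φ t x 1 ≠ 0 := (hd t).1.2
    rw [Vhat_eq (hd t).1]
    have e0 := exp_ne_zero (Φ t x 3 * Φ t x 1)
    have e1 := exp_ne_zero (-(Φ t x 2 * Φ t x 0))
    ext
    · simp [targetDeriv]
      rw [show target (Φ t x) 0 = Φ t x 0 * exp (Φ t x 3 * Φ t x 1) from rfl]
      field_simp
      simp
    · simp [targetDeriv]
      rw [show target (Φ t x) 1 = Φ t x 1 * exp (-(Φ t x 2 * Φ t x 0)) from rfl]
      field_simp
      simp
  have hr : ∀ t, logAbs (target (Φ t x)) = flow t (logAbs (target x)) := congrFun hlog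
  ext k
  fin_cases k
  · exact e0 t
  · exact e1 t
  · have := hconst 2 (fun s => -((disp s (logAbs (target x))).2 / x 0)) (fun t => by
      rw [Vhat_eq (hd t).1, hr, e0]
      refine ((hasDerivAt_snd_comp (hasDerivAt_disp (logAbs (target x)) t)).ofReal_comp.div_const
        (x 0)).fun_neg.congr_deriv ?_
      simp [neg_div]) t
    simpa [groupoidFlow, disp_zero, sub_eq_add_neg] using this
  · have := hconst 3 (fun s => (disp s (logAbs (target x))).1 / x 1) (fun t => by
      rw [Vhat_eq (hd t).1, hr, e1]
      exact (hasDerivAt_fst_comp (hasDerivAt_disp (logAbs (target x)) t)).ofReal_comp.div_const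
        (x 1)) t
    simpa [groupoidFlow, disp_zero] using this

end

/-! ### The two-form of the flowed structure -/

section

open Set Filter Topology MeasureTheory

/-- The derivative of the displacement in the chart. -/
def dDisp (t : ℝ) (z : Chart) : Chart →L[ℝ] ℝ × ℝ := (dispDeriv t (logAbs z)).comp (dlogAbs z)

theorem hasFDerivAt_disp_logAbs {z : Chart} (hz : z ∈ torus) (t : ℝ) :
    HasFDerivAt (fun z => disp t (logAbs z)) (dDisp t z) z :=
  (hasFDerivAt_disp t (logAbs z)).comp z (hasFDerivAt_logAbs hz)

theorem apply_eq_of_prod (D : ℝ × ℝ →L[ℝ] ℝ × ℝ) (a b : ℝ) :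
    D (a, b) = (a * (D (1, 0)).1 + b * (D (0, 1)).1, a * (D (1, 0)).2 + b * (D (0, 1)).2) := by
  have : ((a, b) : ℝ × ℝ) = a • (1, 0) + b • (0, 1) := by simp
  rw [this, map_add, map_smul, map_smul]
  rfl

/-- The derivative of the flow on the chart. -/
def chartFlowDeriv (t : ℝ) (z : Chart) : Chart →L[ℝ] Chart :=
  ContinuousLinearMap.pi
    ![chartFlow t z 0 • (dlog z 0 +
        ofRealCLM.comp ((ContinuousLinearMap.fst ℝ ℝ ℝ).comp (dDisp t z))),
      chartFlow t z 1 • (dlog z 1 +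
        ofRealCLM.comp ((ContinuousLinearMap.snd ℝ ℝ ℝ).comp (dDisp t z)))]

theorem chartFlowDeriv_apply (t : ℝ) (z v : Chart) : chartFlowDeriv t z v =
    ![chartFlow t z 0 * (v 0 / z 0 + (dDisp t z v).1),
      chartFlow t z 1 * (v 1 / z 1 + (dDisp t z v).2)] := by
  ext k; fin_cases k <;> simp [chartFlowDeriv] <;> ring

theorem hasFDerivAt_chartFlow {z : Chart} (hz : z ∈ torus) (t : ℝ) :
    HasFDerivAt (chartFlow t) (chartFlowDeriv t z) z := by
  have hR := hasFDerivAt_disp_logAbs hz t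
  have hp : ∀ k, HasFDerivAt (fun z : Chart => z k)
      (ContinuousLinearMap.proj (R := ℝ) (φ := fun _ => ℂ) k) z := fun k => hasFDerivAt_apply k z
  have h0 : z 0 ≠ 0 := hz.1
  have h1 : z 1 ≠ 0 := hz.2
  refine (hasFDerivAt_vec2 ((hp 0).mul (ofRealCLM.hasFDerivAt.comp z hR.fst).cexp)
    ((hp 1).mul (ofRealCLM.hasFDerivAt.comp z hR.snd).cexp)).congr_fderiv ?_
  ext v k
  rw [chartFlowDeriv_apply]
  fin_cases k <;> simp [chartFlow] <;> field_simp <;> ring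

theorem var_eq (t : ℝ) (r v : ℝ × ℝ) : var t r v = v + dispDeriv t r v := by
  simp [dispDeriv]

theorem det_one_add_dispDeriv (t : ℝ) (r : ℝ × ℝ) :
    (1 + (dispDeriv t r (1, 0)).1) * (1 + (dispDeriv t r (0, 1)).2)
      - (dispDeriv t r (1, 0)).2 * (dispDeriv t r (0, 1)).1 = 1 := by
  have := det_var t r
  simpa [var_eq] using this

theorem dDisp_apply (t : ℝ) (z v : Chart) : dDisp t z v =
    ((v 0 / z 0).re * (dispDeriv t (logAbs z) (1, 0)).1
        + (v 1 / z 1).re * (dispDeriv t (logAbs z) (0, 1)).1,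
      (v 0 / z 0).re * (dispDeriv t (logAbs z) (1, 0)).2
        + (v 1 / z 1).re * (dispDeriv t (logAbs z) (0, 1)).2) := by
  rw [← apply_eq_of_prod, ← dlogAbs_apply]; rfl

theorem chartFlowDeriv_injective {z : Chart} (hz : z ∈ torus) (t : ℝ) :
    Function.Injective (chartFlowDeriv t z) := by
  refine (injective_iff_map_eq_zero _).2 fun v hv => ?_
  rw [chartFlowDeriv_apply, dDisp_apply] at hv
  have hd := det_one_add_dispDeriv t (logAbs z)
  generalize (dispDeriv t (logAbs z) (1, 0)) = a at *
  generalize (dispDeriv t (logAbs z) (0, 1)) = b at *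
  have e0 := (mul_eq_zero.1 (congrFun hv 0)).resolve_left (chartFlow_mem hz t).1
  have e1 := (mul_eq_zero.1 (congrFun hv 1)).resolve_left (chartFlow_mem hz t).2
  have r0 := congrArg re e0
  have r1 := congrArg re e1
  simp only [add_re, ofReal_re, zero_re] at r0 r1
  have x0 : (v 0 / z 0).re = 0 := by
    linear_combination (1 + b.2) * r0 - b.1 * r1 - (v 0 / z 0).re * hd
  have x1 : (v 1 / z 1).re = 0 := by
    linear_combination (1 + a.1) * r1 - a.2 * r0 - (v 1 / z 1).re * hd
  rw [x0, x1] at e0 e1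
  simp only [zero_mul, add_zero, ofReal_zero, div_eq_zero_iff] at e0 e1
  ext k
  fin_cases k
  · exact e0.resolve_right hz.1
  · exact e1.resolve_right hz.2

/-- The 2-form `F` of the flowed structure. With `B = i d log z₁ ∧ d log z₂` the inverse of `σ` up
to sign, it is `φ_t^*B - B`, see `logForm_chartFlow_sub`. -/
def F (t : ℝ) (z : Chart) : Chart →L[ℝ] Chart →L[ℝ] ℝ :=
  let ρ₁ := (ContinuousLinearMap.fst ℝ ℝ ℝ).comp (dDisp t z)
  let ρ₂ := (ContinuousLinearMap.snd ℝ ℝ ℝ).comp (dDisp t z)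
  let θ := fun k => imCLM.comp (dlog z k)
  ρ₂.smulRight (θ 0) - (θ 0).smulRight ρ₂ - ρ₁.smulRight (θ 1) + (θ 1).smulRight ρ₁

theorem F_apply (t : ℝ) (z u v : Chart) : F t z u v =
    (dDisp t z u).2 * (v 0 / z 0).im - (u 0 / z 0).im * (dDisp t z v).2
      - (dDisp t z u).1 * (v 1 / z 1).im + (u 1 / z 1).im * (dDisp t z v).1 := by
  simp [F]

/-- The real part of `φ_t^*B - B` vanishes because the planar flow preserves the area. -/
theorem logForm_chartFlow_sub {z : Chart} (hz : z ∈ torus) (t : ℝ) (u v : Chart) :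
    I * (logForm (chartFlow t z) (chartFlowDeriv t z u) (chartFlowDeriv t z v) - logForm z u v)
      = F t z u v := by
  have h0 : z 0 ≠ 0 := hz.1
  have h1 : z 1 ≠ 0 := hz.2
  have k0 : chartFlow t z 0 ≠ 0 := (chartFlow_mem hz t).1
  have k1 : chartFlow t z 1 ≠ 0 := (chartFlow_mem hz t).2
  have e : logForm (chartFlow t z) (chartFlowDeriv t z u) (chartFlowDeriv t z v) - logForm z u v =
      ((u 0 / z 0 + (dDisp t z u).1) * (v 1 / z 1 + (dDisp t z v).2)
        - (u 1 / z 1 + (dDisp t z u).2) * (v 0 / z 0 + (dDisp t z v).1))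
      - ((u 0 / z 0) * (v 1 / z 1) - (u 1 / z 1) * (v 0 / z 0)) := by
    rw [chartFlowDeriv_apply, chartFlowDeriv_apply, logForm, logForm]
    simp only [Matrix.cons_val]
    field_simp
  rw [e, F_apply]
  have hd := det_one_add_dispDeriv t (logAbs z)
  rw [dDisp_apply, dDisp_apply]
  generalize (dispDeriv t (logAbs z) (1, 0)) = a at *
  generalize (dispDeriv t (logAbs z) (0, 1)) = b at *
  generalize u 0 / z 0 = u0
  generalize u 1 / z 1 = u1
  generalize v 0 / z 0 = v0
  generalize v 1 / z 1 = v1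
  apply Complex.ext
  · simp; ring
  · simp
    linear_combination (u0.re * v1.re - u1.re * v0.re) * hd

/-- The complex components of the covector `F(u, ·)`. -/
theorem F_apply_eq_re {z : Chart} (t : ℝ) (u v : Chart) :
    F t z u v = (∑ k,
      ![(-I * (dDisp t z u).2 - (u 0 / z 0).im * (dispDeriv t (logAbs z) (1, 0)).2
            + (u 1 / z 1).im * (dispDeriv t (logAbs z) (1, 0)).1) / z 0,
        (I * (dDisp t z u).1 - (u 0 / z 0).im * (dispDeriv t (logAbs z) (0, 1)).2
            + (u 1 / z 1).im * (dispDeriv t (logAbs z) (0, 1)).1) / z 1] k * v k).re := by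
  rw [F_apply, dDisp_apply t z v]
  simp only [Fin.sum_univ_two, Matrix.cons_val, div_mul_eq_mul_div, mul_div_assoc]
  generalize (dispDeriv t (logAbs z) (1, 0)) = a at *
  generalize (dispDeriv t (logAbs z) (0, 1)) = b at *
  generalize u 0 / z 0 = u0
  generalize u 1 / z 1 = u1
  generalize v 0 / z 0 = v0
  generalize v 1 / z 1 = v1
  simp
  ring

theorem inverse_apply_of_injective {E : Type*} [NormedAddCommGroup E]
    [NormedSpace ℝ E] [FiniteDimensional ℝ E] {A : E →L[ℝ] E} (hA : Function.Injective A) (w : E) :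
    A.inverse (A w) = w := by
  let e := (LinearEquiv.ofInjectiveEndo (A : E →ₗ[ℝ] E) hA).toContinuousLinearEquiv
  have h : A = (e : E →L[ℝ] E) := by ext v; rfl
  rw [h, ContinuousLinearMap.inverse_equiv]
  exact e.symm_apply_apply w

/-- `I₊ - I₋ = -Q F`. -/
theorem Iplus_sub {φ : ℝ → Chart → Chart} {t : ℝ} {z : Chart} (hz : z ∈ torus)
    (hφ : HasFDerivAt (φ t) (chartFlowDeriv t z) z) (u : Chart) :
    Iplus (φ t) z u - I • u = sharp (sigma z) (F t z u) := by
  rw [sub_eq_iff_eq_add, Iplus, hφ.fderiv]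
  suffices h : I • chartFlowDeriv t z u
      = chartFlowDeriv t z (sharp (sigma z) (F t z u) + I • u) by
    rw [h, inverse_apply_of_injective (chartFlowDeriv_injective hz t)]
  have h0 : z 0 ≠ 0 := hz.1
  have h1 : z 1 ≠ 0 := hz.2
  have hs := sharp_of_re (sigma z) (F_apply_eq_re (z := z) t u)
  set s := sharp (sigma z) (F t z u)
  have s0 : (s + I • u) 0 / z 0 = (I * (dDisp t z u).1
      - (u 0 / z 0).im * (dispDeriv t (logAbs z) (0, 1)).2
      + (u 1 / z 1).im * (dispDeriv t (logAbs z) (0, 1)).1) + I * (u 0 / z 0) := by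
    rw [Pi.add_apply, hs]
    simp [sigma]; field_simp; ring_nf; simp only [I_sq, I_pow_three]; ring
  have s1 : (s + I • u) 1 / z 1 = -(-I * (dDisp t z u).2
      - (u 0 / z 0).im * (dispDeriv t (logAbs z) (1, 0)).2
      + (u 1 / z 1).im * (dispDeriv t (logAbs z) (1, 0)).1) + I * (u 1 / z 1) := by
    rw [Pi.add_apply, hs]
    simp [sigma]; field_simp; ring_nf; simp only [I_sq, I_pow_three]; ring
  have hd := det_one_add_dispDeriv t (logAbs z)
  rw [chartFlowDeriv_apply, chartFlowDeriv_apply, dDisp_apply t z (s + I • u), s0, s1]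
  generalize (dispDeriv t (logAbs z) (1, 0)) = a at *
  generalize (dispDeriv t (logAbs z) (0, 1)) = b at *
  generalize dDisp t z u = ρ at *
  ext k
  fin_cases k
  · simp only [Pi.smul_apply, smul_eq_mul, Fin.zero_eta, Matrix.cons_val]
    rw [mul_left_comm]
    congr 1
    apply Complex.ext
    · simp
      linear_combination (u 0 / z 0).im * hd
    · simp; ring
  · simp only [Pi.smul_apply, smul_eq_mul, Fin.mk_one, Matrix.cons_val]
    rw [mul_left_comm]
    congr 1
    apply Complex.ext
    · simp
      linear_combination (u 1 / z 1).im * hd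
    · simp; ring

end

/-! ### Darboux coordinates and the generalised Kähler potential -/

section

open Set Filter Topology MeasureTheory

/-- The inverse function theorem, in a form that gives the derivative of the local inverse at every
point of its domain. -/
theorem exists_openPartialHomeomorph_of_bijective_fderiv {E G : Type*} [NormedAddCommGroup E]
    [NormedSpace ℝ E] [CompleteSpace E] [NormedAddCommGroup G] [NormedSpace ℝ G] [CompleteSpace G]
    {f : E → G} {S : Set E} (hS : IsOpen S) (hf : ContDiffOn ℝ 1 f S) {z : E} (hz : z ∈ S)
    (hb : Function.Bijective (fderiv ℝ f z)) :
    ∃ e : OpenPartialHomeomorph E G, z ∈ e.source ∧ e.source ⊆ S ∧ (∀ z' ∈ e.source, e z' = f z') ∧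
      ∀ w ∈ e.target, ∃ g : G →L[ℝ] E, HasFDerivAt e.symm g w ∧
        ∀ v, fderiv ℝ f (e.symm w) (g v) = v := by
  have hd : ∀ z ∈ S, HasFDerivAt f (fderiv ℝ f z) z := fun z hz =>
    ((hf.contDiffAt (hS.mem_nhds hz)).differentiableAt (by norm_num)).hasFDerivAt
  let f' := ContinuousLinearEquiv.ofBijective (fderiv ℝ f z) (LinearMap.ker_eq_bot.2 hb.1)
    (LinearMap.range_eq_top.2 hb.2)
  have hf' : (f' : E →L[ℝ] G) = fderiv ℝ f z := ContinuousLinearEquiv.coe_ofBijective ..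
  have hc := hf.contDiffAt (hS.mem_nhds hz)
  let e₀ := hc.toOpenPartialHomeomorph f (f' := f') (hf' ▸ hd z hz) (by norm_num)
  have hU : IsOpen (S ∩ fderiv ℝ f ⁻¹' range ((↑) : (E ≃L[ℝ] G) → E →L[ℝ] G)) :=
    (hf.continuousOn_fderiv_of_isOpen hS le_rfl).isOpen_inter_preimage hS
      ContinuousLinearEquiv.isOpen
  refine ⟨e₀.restrOpen _ hU, ⟨hc.mem_toOpenPartialHomeomorph_source _ _, hz, f', hf'⟩,
    fun z' hz' => hz'.2.1, fun _ _ => rfl, fun w hw => ?_⟩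
  obtain ⟨hwS, L, hL⟩ := ((e₀.restrOpen _ hU).map_target hw).2
  have hg := (e₀.restrOpen _ hU).hasFDerivAt_symm hw (f' := L) (hL ▸ hd _ hwS)
  exact ⟨_, hg, fun v => by
    have : fderiv ℝ f ((e₀.restrOpen _ hU).symm w) = L := hL.symm
    rw [this]; simp⟩

theorem contDiffOn_logAbs : ContDiffOn ℝ 1 logAbs torus := fun z hz => by
  have hp : ∀ k, ContDiffAt ℝ 1 (fun z : Chart => z k) z := fun k => contDiffAt_apply ℝ ℂ k z
  have h := ((((hp 0).norm ℝ hz.1).log (norm_ne_zero_iff.2 hz.1)).prodMk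
    (((hp 1).norm ℝ hz.2).log (norm_ne_zero_iff.2 hz.2)))
  exact h.contDiffWithinAt

/-- The coordinates `Q` on the space of units. -/
def unitsQ (t : ℝ) (z : Chart) : Fin 2 → ℂ :=
  ![z 0 * exp ((disp t (logAbs z)).1 / 2 : ℝ), z 1 * exp ((disp t (logAbs z)).2 / 2 : ℝ)]

/-- The derivative of the coordinates `Q` on the space of units. -/
def unitsQDeriv (t : ℝ) (z : Chart) : Chart →L[ℝ] Fin 2 → ℂ :=
  ContinuousLinearMap.pi
    ![unitsQ t z 0 • (dlog z 0 + (1 / 2 : ℝ) •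
        ofRealCLM.comp ((ContinuousLinearMap.fst ℝ ℝ ℝ).comp (dDisp t z))),
      unitsQ t z 1 • (dlog z 1 + (1 / 2 : ℝ) •
        ofRealCLM.comp ((ContinuousLinearMap.snd ℝ ℝ ℝ).comp (dDisp t z)))]

theorem unitsQDeriv_apply (t : ℝ) (z v : Chart) : unitsQDeriv t z v =
    ![unitsQ t z 0 * (v 0 / z 0 + ((dDisp t z v).1 / 2 : ℝ)),
      unitsQ t z 1 * (v 1 / z 1 + ((dDisp t z v).2 / 2 : ℝ))] := by
  ext k; fin_cases k <;> simp [unitsQDeriv] <;> ring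

theorem hasFDerivAt_unitsQ {z : Chart} (hz : z ∈ torus) (t : ℝ) :
    HasFDerivAt (unitsQ t) (unitsQDeriv t z) z := by
  have hR := hasFDerivAt_disp_logAbs hz t
  have hp : ∀ k, HasFDerivAt (fun z : Chart => z k)
      (ContinuousLinearMap.proj (R := ℝ) (φ := fun _ => ℂ) k) z := fun k => hasFDerivAt_apply k z
  have h0 : z 0 ≠ 0 := hz.1
  have h1 : z 1 ≠ 0 := hz.2
  refine (hasFDerivAt_vec2
    ((hp 0).mul (ofRealCLM.hasFDerivAt.comp z (hR.fst.mul_const (2⁻¹ : ℝ))).cexp)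
    ((hp 1).mul (ofRealCLM.hasFDerivAt.comp z (hR.snd.mul_const (2⁻¹ : ℝ))).cexp)).congr_fderiv ?_
  ext v k
  rw [unitsQDeriv_apply]
  fin_cases k <;> simp [unitsQ, div_eq_mul_inv] <;> field_simp <;> ring

theorem contDiffOn_unitsQ (t : ℝ) : ContDiffOn ℝ 1 (unitsQ t) torus := by
  have hR : ContDiffOn ℝ 1 (fun z => disp t (logAbs z)) torus :=
    (contDiff_disp t).comp_contDiffOn contDiffOn_logAbs
  refine contDiffOn_pi.2 fun k => ?_
  have hp : ContDiffOn ℝ 1 (fun z : Chart => z k) torus := (contDiff_apply ℝ ℂ k).contDiffOn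
  fin_cases k
  · exact hp.mul (ofRealCLM.contDiff.comp_contDiffOn (hR.fst.div_const 2)).cexp
  · exact hp.mul (ofRealCLM.contDiff.comp_contDiffOn (hR.snd.div_const 2)).cexp

theorem unit_mem {z : Chart} (hz : z ∈ torus) : unit z ∈ torusX := hz

theorem target_unit (z : Chart) : target (unit z) = z := by
  ext k; fin_cases k <;> simp [target, unit]

theorem groupoidFlow_unit (t : ℝ) (z : Chart) : groupoidFlow t (unit z) =
    ![z 0, z 1, -(disp t (logAbs z)).2 / z 0, (disp t (logAbs z)).1 / z 1] := by
  rw [groupoidFlow, target_unit]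
  simp [unit, neg_div]

theorem q_groupoidFlow_unit {z : Chart} (hz : z ∈ torus) (t : ℝ) :
    q (groupoidFlow t (unit z)) = unitsQ t z := by
  have h0 : z 0 ≠ 0 := hz.1
  have h1 : z 1 ≠ 0 := hz.2
  simp only [groupoidFlow_unit, q, unitsQ, Matrix.cons_val]
  push_cast
  congr 3
  · field_simp
  · field_simp

/-- On the units `P_1 Q_1 = -R₂` and `P_2 Q_2 = R₁`. -/
theorem p_groupoidFlow_unit {z : Chart} (hz : z ∈ torus) (t : ℝ) :
    p (groupoidFlow t (unit z)) = ![-(disp t (logAbs z)).2 / unitsQ t z 0,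
      (disp t (logAbs z)).1 / unitsQ t z 1] := by
  have h0 : z 0 ≠ 0 := hz.1
  have h1 : z 1 ≠ 0 := hz.2
  simp only [groupoidFlow_unit, p, unitsQ, Matrix.cons_val]
  ext k
  fin_cases k
  · simp [div_eq_mul_inv, Complex.exp_neg]
    field_simp
  · simp [div_eq_mul_inv, ← Complex.exp_neg]
    field_simp

theorem unitsQ_ne_zero {z : Chart} (hz : z ∈ torus) (t : ℝ) :
    unitsQ t z 0 ≠ 0 ∧ unitsQ t z 1 ≠ 0 :=
  ⟨mul_ne_zero hz.1 (exp_ne_zero _), mul_ne_zero hz.2 (exp_ne_zero _)⟩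

/-- `Re ∑ P_k dQ^k = -dK` on the units, with `K = pot t ∘ logAbs`. -/
theorem re_eta_eq {z : Chart} (hz : z ∈ torus) (t : ℝ) (v : Chart) :
    (∑ k, p (groupoidFlow t (unit z)) k * unitsQDeriv t z v k).re
      = -potDeriv t (logAbs z) (dlogAbs z v) := by
  obtain ⟨h0, h1⟩ := unitsQ_ne_zero hz t
  rw [p_groupoidFlow_unit hz, unitsQDeriv_apply]
  simp only [Fin.sum_univ_two, Matrix.cons_val]
  have e : -((disp t (logAbs z)).2 : ℂ) / unitsQ t z 0 *
        (unitsQ t z 0 * (v 0 / z 0 + ((dDisp t z v).1 / 2 : ℝ)))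
      + (disp t (logAbs z)).1 / unitsQ t z 1 *
        (unitsQ t z 1 * (v 1 / z 1 + ((dDisp t z v).2 / 2 : ℝ)))
      = -(disp t (logAbs z)).2 * (v 0 / z 0 + ((dDisp t z v).1 / 2 : ℝ))
        + (disp t (logAbs z)).1 * (v 1 / z 1 + ((dDisp t z v).2 / 2 : ℝ)) := by
    field_simp
  have hD : dispDeriv t (logAbs z) ((v 0 / z 0).re, (v 1 / z 1).re) = dDisp t z v := by
    rw [← dlogAbs_apply]; rfl
  rw [e]
  simp only [potDeriv, dlogAbs_apply, sub_apply, smul_apply, ContinuousLinearMap.comp_apply,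
    ContinuousLinearMap.coe_fst', ContinuousLinearMap.coe_snd', hD, smul_eq_mul]
  simp
  ring

/-- The coordinates `Q` are nondegenerate on the units as soon as `1 + ½ DR_t` is. -/
theorem unitsQDeriv_bijective {z : Chart} (hz : z ∈ torus) {t : ℝ}
    (hδ : (1 + (dispDeriv t (logAbs z) (1, 0)).1 / 2) * (1 + (dispDeriv t (logAbs z) (0, 1)).2 / 2)
      - (dispDeriv t (logAbs z) (1, 0)).2 / 2 * ((dispDeriv t (logAbs z) (0, 1)).1 / 2) ≠ 0) :
    Function.Bijective (unitsQDeriv t z) := by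
  have hinj : Function.Injective (unitsQDeriv t z) := by
    refine (injective_iff_map_eq_zero _).2 fun v hv => ?_
    rw [unitsQDeriv_apply, dDisp_apply] at hv
    generalize (dispDeriv t (logAbs z) (1, 0)) = a at *
    generalize (dispDeriv t (logAbs z) (0, 1)) = b at *
    have e0 := (mul_eq_zero.1 (congrFun hv 0)).resolve_left (unitsQ_ne_zero hz t).1
    have e1 := (mul_eq_zero.1 (congrFun hv 1)).resolve_left (unitsQ_ne_zero hz t).2
    have r0 := congrArg re e0
    have r1 := congrArg re e1
    simp only [add_re, ofReal_re, zero_re] at r0 r1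
    have x0 : (v 0 / z 0).re = 0 := (mul_eq_zero.1 (show _ * (v 0 / z 0).re = 0 by
      linear_combination (1 + b.2 / 2) * r0 - b.1 / 2 * r1)).resolve_left hδ
    have x1 : (v 1 / z 1).re = 0 := (mul_eq_zero.1 (show _ * (v 1 / z 1).re = 0 by
      linear_combination (1 + a.1 / 2) * r1 - a.2 / 2 * r0)).resolve_left hδ
    rw [x0, x1] at e0 e1
    simp only [zero_mul, add_zero, zero_div, ofReal_zero, div_eq_zero_iff] at e0 e1
    ext k
    fin_cases k
    · exact e0.resolve_right hz.1
    · exact e1.resolve_right hz.2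
  exact ⟨hinj, (LinearMap.injective_iff_surjective (f := (unitsQDeriv t z : Chart →ₗ[ℝ] Chart))).1
    hinj⟩

/-- At time zero `Q` restricts to the identity of the chart, so by continuity `Q` is nondegenerate
for small times. -/
theorem eventually_unitsQDeriv_bijective {z : Chart} (hz : z ∈ torus) :
    ∀ᶠ t in 𝓝 (0 : ℝ), Function.Bijective (unitsQDeriv t z) := by
  have hc : ∀ v, ContinuousAt (fun t => dispDeriv t (logAbs z) v) 0 := fun v =>
    (hasDerivAt_dispDeriv (logAbs z) 0 v).continuousAt
  have h1 := hc (1, 0)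
  have h2 := hc (0, 1)
  have : ContinuousAt (fun t => (1 + (dispDeriv t (logAbs z) (1, 0)).1 / 2) *
      (1 + (dispDeriv t (logAbs z) (0, 1)).2 / 2)
      - (dispDeriv t (logAbs z) (1, 0)).2 / 2 * ((dispDeriv t (logAbs z) (0, 1)).1 / 2)) 0 :=
    (((continuousAt_const.add (h1.fst.div_const 2)).mul
      (continuousAt_const.add (h2.snd.div_const 2)))).sub
      ((h1.snd.div_const 2).mul (h2.fst.div_const 2))
  have h := this.eventually_ne (y := 0) (by simp [dispDeriv, var_zero])
  exact h.mono fun t ht => unitsQDeriv_bijective hz ht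

/-- The entropy integrand of the potential in terms of the planar flow: conservation of the
Hamiltonian eliminates the logarithm of the normalisation. -/
theorem sum_mul_log_eq_sweep (s : ℝ) (r : ℝ × ℝ) :
    m₁ (flow s r) * Real.log (m₁ (flow s r) / m₁ r)
      + m₂ (flow s r) * Real.log (m₂ (flow s r) / m₂ r)
      + (1 - m₁ (flow s r) - m₂ (flow s r)) *
        Real.log ((1 - m₁ (flow s r) - m₂ (flow s r)) / (1 - m₁ r - m₂ r))
      = 4 / 3 * sweep s r := by
  have hH := ham_flow s r
  rw [Real.log_div (m₁_pos _).ne' (m₁_pos _).ne', Real.log_div (m₂_pos _).ne' (m₂_pos _).ne',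
    Real.log_div (m₃_pos _).ne' (m₃_pos _).ne']
  simp only [log_m₁, log_m₂, log_one_sub_m₁_sub_m₂, sweep, disp, field, Prod.fst_sub, Prod.snd_sub]
  simp only [ham] at hH
  linear_combination (-4 / 3) * hH

theorem potential_eq {φ : ℝ → Chart → Chart} (hφ : IsFlowOn torus V φ) (t : ℝ) {z : Chart}
    (hz : z ∈ torus) : potential φ t z = pot t (logAbs z) := by
  have hi : ∀ s, ∑ i, y (φ s z) i * Real.log (y (φ s z) i / y z i)
      = 4 / 3 * sweep s (logAbs z) := fun s => by
    rw [hφ.eq_chartFlow hz, y_eq (chartFlow_mem hz s), y_eq hz, logAbs_chartFlow hz,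
      ← sum_mul_log_eq_sweep, Fin.sum_univ_three]
    simp
  rw [potential, pot, log_c₃_eq hz]
  simp only [hi, intervalIntegral.integral_const_mul]
  ring

theorem hasFDerivAt_potential {φ : ℝ → Chart → Chart} (hφ : IsFlowOn torus V φ) (t : ℝ) {z : Chart}
    (hz : z ∈ torus) :
    HasFDerivAt (potential φ t) ((potDeriv t (logAbs z)).comp (dlogAbs z)) z :=
  ((hasFDerivAt_pot t (logAbs z)).comp z (hasFDerivAt_logAbs hz)).congr_of_eventuallyEq
    (eventually_of_mem (isOpen_torus.mem_nhds hz) fun _ hw => potential_eq hφ t hw)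

theorem differentiableAt_groupoidFlow {x : X} (hx : x ∈ torusX) (t : ℝ) :
    DifferentiableAt ℝ (groupoidFlow t) x := by
  have hR := ((hasFDerivAt_disp_logAbs (target_mem hx) t).comp x
    (hasFDerivAt_target x)).differentiableAt
  have c := fun k => (hasFDerivAt_coord x k).differentiableAt
  refine differentiableAt_pi.2 fun k => ?_
  fin_cases k
  · exact c 0
  · exact c 1
  · exact (c 2).sub ((ofRealCLM.differentiableAt.comp x hR.snd).mul ((c 0).inv hx.1))
  · exact (c 3).add ((ofRealCLM.differentiableAt.comp x hR.fst).mul ((c 1).inv hx.2))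

/-- The Darboux coordinates of `Ω₀` pulled back by the flow are Darboux coordinates for
`Ω₀ + t^*F = Φ_t^* Ω₀`. -/
theorem isDarbouxOn_flow {Φ : ℝ → X → X} (hΦ : IsFlowOn torusX Vhat Φ) (t : ℝ) :
    IsDarbouxOn torusX (fun x u v => Omega x u v +
      (F t (target x) (fderiv ℝ target x u) (fderiv ℝ target x v) : ℂ))
      (fun x => p (Φ t x)) (fun x => q (Φ t x)) := by
  have hev : ∀ x ∈ torusX, Φ t =ᶠ[𝓝 x] groupoidFlow t := fun x hx =>
    eventually_of_mem (isOpen_torusX.mem_nhds hx) fun _ hw => hΦ.eq_groupoidFlow hw t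
  have hD : ∀ x ∈ torusX, HasFDerivAt (Φ t) (fderiv ℝ (groupoidFlow t) x) x := fun x hx =>
    (differentiableAt_groupoidFlow hx t).hasFDerivAt.congr_of_eventuallyEq (hev x hx)
  have hP : ∀ x ∈ torusX, HasFDerivAt (fun x => p (Φ t x))
      ((pDeriv (groupoidFlow t x)).comp (fderiv ℝ (groupoidFlow t) x)) x := fun x hx => by
    have := (hasFDerivAt_p (Φ t x)).comp x (hD x hx)
    rwa [hΦ.eq_groupoidFlow hx t] at this
  have hQ : ∀ x ∈ torusX, HasFDerivAt (fun x => q (Φ t x))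
      ((qDeriv (groupoidFlow t x)).comp (fderiv ℝ (groupoidFlow t) x)) x := fun x hx => by
    have := (hasFDerivAt_q (Φ t x)).comp x (hD x hx)
    rwa [hΦ.eq_groupoidFlow hx t] at this
  -- the flow preserves the source, and its derivative covers that of the flow on the chart
  have hG : ∀ x ∈ torusX, ∀ u, fderiv ℝ (groupoidFlow t) x u 0 = u 0 ∧
      fderiv ℝ (groupoidFlow t) x u 1 = u 1 ∧
      targetDeriv (groupoidFlow t x) (fderiv ℝ (groupoidFlow t) x u)
        = chartFlowDeriv t (target x) (targetDeriv x u) := fun x hx u => by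
    have hg := (differentiableAt_groupoidFlow hx t).hasFDerivAt
    have g := fun k => hasFDerivAt_pi'.1 hg k
    refine ⟨congrArg (fun l => l u) ((g 0).unique (hasFDerivAt_coord x 0)),
      congrArg (fun l => l u) ((g 1).unique (hasFDerivAt_coord x 1)), ?_⟩
    have h1 := (hasFDerivAt_target (groupoidFlow t x)).comp x hg
    have h2 := ((hasFDerivAt_chartFlow (target_mem hx) t).comp x
      (hasFDerivAt_target x)).congr_of_eventuallyEq (f₁ := target ∘ groupoidFlow t)
      (eventually_of_mem (isOpen_torusX.mem_nhds hx) fun w hw => target_groupoidFlow hw t)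
    exact congrArg (fun l => l u) (h1.unique h2)
  refine ⟨fun x hx => (hP x hx).differentiableAt, fun x hx => (hQ x hx).differentiableAt,
    fun x hx => ?_, fun x hx u v => ?_⟩
  · rw [(hP x hx).fderiv, (hQ x hx).fderiv]
    let A : X →ₗ[ℝ] (Fin 2 → ℂ) × (Fin 2 → ℂ) :=
      ((((pDeriv (groupoidFlow t x)).comp (fderiv ℝ (groupoidFlow t) x)).prod
        ((qDeriv (groupoidFlow t x)).comp (fderiv ℝ (groupoidFlow t) x)) :
        X →L[ℝ] (Fin 2 → ℂ) × (Fin 2 → ℂ)) : X →ₗ[ℝ] (Fin 2 → ℂ) × (Fin 2 → ℂ))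
    have hinj : Function.Injective A := by
      refine (injective_iff_map_eq_zero _).2 fun u hu => ?_
      have hu' : fderiv ℝ (groupoidFlow t) x u = 0 :=
        eq_zero_of_pDeriv_qDeriv (congrArg Prod.fst hu) (congrArg Prod.snd hu)
      obtain ⟨g0, g1, g2⟩ := hG x hx u
      rw [hu'] at g0 g1 g2
      have ht : targetDeriv x u = 0 :=
        chartFlowDeriv_injective (target_mem hx) t (by rw [← g2, map_zero, map_zero])
      have t0 := congrFun ht 0
      have t1 := congrFun ht 1
      have h0 : x 0 ≠ 0 := hx.1
      have h1 : x 1 ≠ 0 := hx.2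
      simp [targetDeriv, ← g0, ← g1, h0, h1] at t0 t1
      ext k
      fin_cases k
      · exact g0.symm
      · exact g1.symm
      · exact t1
      · exact t0
    have hrank : Module.finrank ℝ X = Module.finrank ℝ ((Fin 2 → ℂ) × (Fin 2 → ℂ)) := by
      simp [Module.finrank_pi_fintype]
    exact ⟨hinj, (LinearMap.injective_iff_surjective_of_finrank_eq_finrank hrank).1 hinj⟩
  · obtain ⟨u0, u1, u2⟩ := hG x hx u
    obtain ⟨v0, v1, v2⟩ := hG x hx v
    have hΩ := Omega_eq_target_sub_source (groupoidFlow_mem hx t)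
      (fderiv ℝ (groupoidFlow t) x u) (fderiv ℝ (groupoidFlow t) x v)
    rw [u0, u1, u2, v0, v1, v2, target_groupoidFlow hx, Omega_eq_dp_wedge_dq] at hΩ
    have hx0 : groupoidFlow t x 0 = x 0 := rfl
    have hx1 : groupoidFlow t x 1 = x 1 := rfl
    rw [hx0, hx1] at hΩ
    rw [(hP x hx).fderiv, (hQ x hx).fderiv, (hasFDerivAt_target x).fderiv,
      ← logForm_chartFlow_sub (target_mem hx), Omega_eq_target_sub_source hx]
    refine Eq.trans ?_ hΩ.symm
    ring

theorem hasFDerivAt_q_flow_unit {Φ : ℝ → X → X} (hΦ : IsFlowOn torusX Vhat Φ) (t : ℝ) {z : Chart}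
    (hz : z ∈ torus) : HasFDerivAt (fun z' => q (Φ t (unit z'))) (unitsQDeriv t z) z :=
  (hasFDerivAt_unitsQ hz t).congr_of_eventuallyEq
    (eventually_of_mem (isOpen_torus.mem_nhds hz) fun _ hw => by
      simp only [hΦ.eq_groupoidFlow (unit_mem hw), q_groupoidFlow_unit hw])

theorem isGKPOn_flow {φ : ℝ → Chart → Chart} {Φ : ℝ → X → X} (hφ : IsFlowOn torus V φ)
    (hΦ : IsFlowOn torusX Vhat Φ) (t : ℝ) :
    IsGKPOn torus (fun x u v => Omega x u v +
      (F t (target x) (fderiv ℝ target x u) (fderiv ℝ target x v) : ℂ))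
      (fun x => p (Φ t x)) (fun x => q (Φ t x)) (potential φ t) := by
  have hη : ∀ z ∈ torus, ∀ v, (∑ k, p (Φ t (unit z)) k *
      fderiv ℝ (fun z' => q (Φ t (unit z'))) z v k).re = -fderiv ℝ (potential φ t) z v :=
    fun z hz v => by
      rw [(hasFDerivAt_q_flow_unit hΦ t hz).fderiv, (hasFDerivAt_potential hφ t hz).fderiv,
        hΦ.eq_groupoidFlow (unit_mem hz), re_eta_eq hz]
      rfl
  refine ⟨isDarbouxOn_flow hΦ t, fun z hz => (hasFDerivAt_potential hφ t hz).differentiableAt, hη,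
    fun z hz hb => ?_⟩
  have hcd : ContDiffOn ℝ 1 (fun z' => q (Φ t (unit z'))) torus :=
    (contDiffOn_unitsQ t).congr fun w hw => by
      rw [hΦ.eq_groupoidFlow (unit_mem hw), q_groupoidFlow_unit hw]
  obtain ⟨e, he, heS, hef, heg⟩ :=
    exists_openPartialHomeomorph_of_bijective_fderiv isOpen_torus hcd hz hb
  refine ⟨e, he, heS, hef, fun w hw => ?_, fun w hw k => ?_⟩
  · obtain ⟨g, hg, -⟩ := heg w hw
    exact hg.differentiableAt.differentiableWithinAt
  · obtain ⟨g, hg, hgv⟩ := heg w hw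
    have hm := heS (e.map_target hw)
    have hK : fderiv ℝ (fun w' => potential φ t (e.symm w')) w
        = (fderiv ℝ (potential φ t) (e.symm w)).comp g :=
      ((hasFDerivAt_potential hφ t hm).differentiableAt.hasFDerivAt.comp w hg).fderiv
    -- `d(K ∘ Q⁻¹) = -Re ∑ P_k dw^k`
    have hre : ∀ v, fderiv ℝ (fun w' => potential φ t (e.symm w')) w v
        = (∑ k, -p (Φ t (unit (e.symm w))) k * v k).re := fun v => by
      have := hη _ hm (g v)
      rw [hgv] at this
      rw [hK, ContinuousLinearMap.comp_apply, ← neg_eq_iff_eq_neg.2 this]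
      simp only [neg_mul, Finset.sum_neg_distrib, neg_re]
    rw [dHol, comp10_of_re hre]
    ring

/-- Along the flow, `ẏ¹ = y¹ (y² - y³)` and cyclically. -/
theorem hasDerivAt_y_flow {φ : ℝ → Chart → Chart} (hφ : IsFlowOn torus V φ) {z : Chart}
    (hz : z ∈ torus) (s : ℝ) (i : Fin 3) : HasDerivAt (fun s => y (φ s z) i)
      (y (φ s z) i * (y (φ s z) (i + 1) - y (φ s z) (i + 2))) s := by
  have hy : ∀ s, y (φ s z) = ![m₁ (flow s (logAbs z)), m₂ (flow s (logAbs z)),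
      1 - m₁ (flow s (logAbs z)) - m₂ (flow s (logAbs z))] := fun s => by
    rw [hφ.eq_chartFlow hz, y_eq (chartFlow_mem hz s), logAbs_chartFlow hz]
  simp only [hy]
  have h1 := (hasFDerivAt_m₁ (flow s (logAbs z))).comp_hasDerivAt s (hasDerivAt_flow (logAbs z) s)
  have h2 := (hasFDerivAt_m₂ (flow s (logAbs z))).comp_hasDerivAt s (hasDerivAt_flow (logAbs z) s)
  fin_cases i
  · exact h1.congr_deriv (by simp [field]; ring)
  · exact h2.congr_deriv (by simp [field]; ring)
  · exact ((h1.const_sub 1).fun_sub h2).congr_deriv (by simp [field]; ring)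

theorem IsFlowOn.hasFDerivAt_chartFlow {φ : ℝ → Chart → Chart} (hφ : IsFlowOn torus V φ)
    {z : Chart} (hz : z ∈ torus) (t : ℝ) : HasFDerivAt (φ t) (chartFlowDeriv t z) z :=
  (GKP.hasFDerivAt_chartFlow hz t).congr_of_eventuallyEq
    (eventually_of_mem (isOpen_torus.mem_nhds hz) fun _ hw => hφ.eq_chartFlow hw t)

theorem y_pos {z : Chart} (hz : z ∈ torus) (i : Fin 3) : 0 < y z i := by
  rw [y_eq hz]
  fin_cases i
  · exact m₁_pos _
  · exact m₂_pos _
  · exact m₃_pos _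

theorem sum_y {z : Chart} (hz : z ∈ torus) : y z 0 + y z 1 + y z 2 = 1 := by
  simp [y_eq hz]

theorem c₃_pos {z : Chart} (hz : z ∈ torus) : 0 < c₃ z := by
  exact mul_pos (mul_pos (y_pos hz 0) (y_pos hz 1)) (y_pos hz 2)

theorem c₃_flow {φ : ℝ → Chart → Chart} (hφ : IsFlowOn torus V φ) {z : Chart} (hz : z ∈ torus)
    (s : ℝ) : c₃ (φ s z) = c₃ z := by
  rw [hφ.eq_chartFlow hz]
  refine Real.log_injOn_pos (c₃_pos (chartFlow_mem hz s)) (c₃_pos hz) ?_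
  rw [log_c₃_eq (chartFlow_mem hz s), log_c₃_eq hz, logAbs_chartFlow hz, ham_flow]

end

end GKP

end

theorem mainTheorem4 :
    (∃ φ : ℝ → GKP.Chart → GKP.Chart, GKP.IsFlowOn GKP.torus GKP.V φ) ∧
    (∃ Φ : ℝ → GKP.X → GKP.X, GKP.IsFlowOn GKP.torusX GKP.Vhat Φ) ∧
    ∀ (φ : ℝ → GKP.Chart → GKP.Chart) (Φ : ℝ → GKP.X → GKP.X),
      GKP.IsFlowOn GKP.torus GKP.V φ → GKP.IsFlowOn GKP.torusX GKP.Vhat Φ →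
      -- the lifted flow covers the flow on the base and preserves the source map
      (∀ x ∈ GKP.torusX, ∀ t, GKP.target (Φ t x) = φ t (GKP.target x) ∧
        Φ t x 0 = x 0 ∧ Φ t x 1 = x 1) ∧
      -- `F` is the 2-form of the flowed structure, `I₊ - I₋ = -QF`, and the potential is that of
      -- `Ω = Ω₀ + t^*F` in the Darboux coordinates pulled back by the lifted flow
      (∀ t : ℝ, ∃ F : GKP.Chart → GKP.Chart →L[ℝ] GKP.Chart →L[ℝ] ℝ,
        (∀ z ∈ GKP.torus, (∀ u, F z u u = 0) ∧ (∀ u,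
          GKP.Iplus (φ t) z u - Complex.I • u = GKP.sharp (GKP.sigma z) (F z u))) ∧
        GKP.IsGKPOn GKP.torus
          (fun x u v => GKP.Omega x u v +
            (F (GKP.target x) (fderiv ℝ GKP.target x u) (fderiv ℝ GKP.target x v) : ℂ))
          (fun x => GKP.p (Φ t x)) (fun x => GKP.q (Φ t x)) (GKP.potential φ t)) ∧
      -- for small times `Q` is a local coordinate system on the flowed Lagrangian
      (∀ z ∈ GKP.torus, ∀ᶠ t in nhds (0 : ℝ),
        Function.Bijective (fderiv ℝ (fun z' => GKP.q (Φ t (GKP.unit z'))) z)) ∧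
      -- the `yⁱ_s` are given by the Weierstrass elliptic function of the lattice with half-periods
      -- `a > 0` and `b i`, where `b > 0`, and invariants `g₂ = 1/12 - 2 c₃`,
      -- `g₃ = c₃/6 - 1/216 - c₃²`
      (∀ z ∈ GKP.torus, ∀ (L : PeriodPair) (a b : ℝ), 0 < a → 0 < b →
        L.ω₁ = 2 * (a : ℂ) → L.ω₂ = 2 * ((b : ℂ) * Complex.I) →
        L.g₂ = 1 / 12 - 2 * (GKP.c₃ z : ℂ) →
        L.g₃ = (GKP.c₃ z : ℂ) / 6 - 1 / 216 - (GKP.c₃ z : ℂ) ^ 2 →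
        ∃ t₀ : ℝ, ∀ (s : ℝ) (i : Fin 3),
          (GKP.y (φ s z) i : ℂ) = (GKP.c₃ z : ℂ) /
            (1 / 12 - L.weierstrassP
              ((b : ℂ) * Complex.I + (t₀ + s : ℝ) + ((i : ℕ) + 1 : ℂ) * (2 / 3 * (a : ℂ))))) := by
  refine ⟨⟨GKP.chartFlow, GKP.isFlowOn_chartFlow⟩,
    ⟨GKP.groupoidFlow, GKP.isFlowOn_groupoidFlow⟩, fun φ Φ hφ hΦ => ⟨fun x hx t => ?_,
    fun t => ⟨GKP.F t, fun z hz => ⟨fun u => ?_, fun u => ?_⟩, GKP.isGKPOn_flow hφ hΦ t⟩,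
    fun z hz => ?_, fun z hz L a b ha hb h1 h2 hg2 hg3 => ?_⟩⟩
  · rw [hΦ.eq_groupoidFlow hx, GKP.target_groupoidFlow hx, hφ.eq_chartFlow (GKP.target_mem hx)]
    exact ⟨rfl, rfl, rfl⟩
  · rw [GKP.F_apply]
    ring
  · exact GKP.Iplus_sub hz (hφ.hasFDerivAt_chartFlow hz t) u
  · refine (GKP.eventually_unitsQDeriv_bijective hz).mono fun t ht => ?_
    rwa [(GKP.hasFDerivAt_q_flow_unit hΦ t hz).fderiv]
  · exact GKP.exists_phase_weierstrassP ha hb h1 h2 hg2 hg3 (u := fun s => GKP.y (φ s z))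
      (fun s => GKP.y_pos (hφ z hz |>.2 s).1) (fun s => GKP.sum_y (hφ z hz |>.2 s).1)
      (fun s => GKP.c₃_flow hφ hz s) (GKP.hasDerivAt_y_flow hφ hz)
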